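/- For a $3$-uniform hypergraph $H$ on $n$ vertices, let $f_H : \{0,1\}^{\binom{n}{3}} \to \{0,1\}$ be the Boolean function whose input bits encode which triples of $\{1,\dots,n\}$ are edges of a $3$-uniform hypergraph $G$ on $n$ vertices, and for which $f_H(G) = 1$ if and only if $G$ contains $H$ as a (not necessarily induced) subgraph, that is, if and only if some injective map from the vertices of $H$ to the vertices of $G$ sends every edge of $H$ to an edge of $G$. For a Boolean function $f$, let $Q(f)$ denote its bounded-error quantum query complexity, that is, the least number $q$ of queries of a quantum query algorithm $U_q O_x U_{q-1} O_x \cdots U_1 O_x U_0$ (with unitaries $U_t$ independent of the input $x$, and $O_x$ the quantum query to $x$) which on every input $x$ outputs $f(x)$ with probability at least $2/3$. **Theorem.** For every $3$-uniform hypergraph $H$ on $n$ vertices with at least one edge, $$Q(f_H) = \Omega(n^{4/5}).$$ That is, there is an absolute constant $c > 0$ such that $Q(f_H) \ge c\, n^{4/5}$ for every $n$ and every $3$-uniform hypergraph $H$ on $n$ vertices (possibly with isolated vertices) that has at least one edge. -/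

import Mathlib

/-! ## Bounded-error quantum query algorithms -/

/-- Basis states `|i, w, b⟩` of an algorithm that queries a string indexed by `ι`: the query
register `i` (`none` is the idle value, at which a query does nothing; it is the standard way to
allow controlled queries), `k` work qubits `w`, and the output qubit `b`, which comes last. -/
abbrev QueryBasis (ι : Type) (k : ℕ) : Type := Option ι × (Fin k → Bool) × Bool

/-- A quantum query algorithm `U_q O U_{q-1} O ⋯ U_1 O U_0`: the number `q` of queries, the number
of work qubits, and unitaries `U_t` that do not depend on the input (only `U_0, …, U_q` are
used). -/
structure QueryAlgorithm (ι : Type) [Fintype ι] [DecidableEq ι] where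
  queries : ℕ
  workQubits : ℕ
  U : ℕ → Matrix.unitaryGroup (QueryBasis ι workQubits) ℂ

/-- The phase query on input `x`: it negates the amplitude of `|i, w, b⟩` if `x i` is true. -/
def queryOracle {ι : Type} {k : ℕ} (x : ι → Bool) (ψ : QueryBasis ι k → ℂ) :
    QueryBasis ι k → ℂ
  | (none, w, b) => ψ (none, w, b)
  | (some i, w, b) => if x i then -ψ (some i, w, b) else ψ (some i, w, b)

namespace QueryAlgorithm

variable {ι : Type} [Fintype ι] [DecidableEq ι]

/-- The state `U_t O U_{t-1} O ⋯ O U_0 |0⟩` on input `x`. -/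
noncomputable def state (A : QueryAlgorithm ι) (x : ι → Bool) :
    ℕ → QueryBasis ι A.workQubits → ℂ
  | 0 => Matrix.mulVec (A.U 0).1 (Pi.single (none, fun _ => false, false) 1)
  | t + 1 => Matrix.mulVec (A.U (t + 1)).1 (queryOracle x (A.state x t))

/-- The probability that the measurement of the output qubit of the final state on input `x`
gives `b`. -/
noncomputable def outputProb (A : QueryAlgorithm ι) (x : ι → Bool) (b : Bool) : ℝ :=
  ∑ i : Option ι, ∑ w : Fin A.workQubits → Bool, ‖A.state x A.queries (i, w, b)‖ ^ 2

/-- `A` computes `f` with bounded error: on every input it outputs the correct value with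
probability at least `2 / 3`. -/
def Computes (A : QueryAlgorithm ι) (f : (ι → Bool) → Bool) : Prop :=
  ∀ x : ι → Bool, 2 / 3 ≤ A.outputProb x (f x)

end QueryAlgorithm

/-- The bounded-error quantum query complexity `Q(f)`: the least number of queries of a quantum
query algorithm that computes `f` with bounded error. -/
noncomputable def quantumQueryComplexity {ι : Type} [Fintype ι] [DecidableEq ι]
    (f : (ι → Bool) → Bool) : ℕ∞ :=
  ⨅ (A : QueryAlgorithm ι) (_ : A.Computes f), (A.queries : ℕ∞)

/-! ## Subgraph isomorphism for 3-uniform hypergraphs -/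

/-- `H` is a 3-uniform hypergraph on the whole vertex set `V`. -/
structure IsThreeUniform {V : Type} (H : Hypergraph V) : Prop where
  vertexSet_eq : H.vertexSet = Set.univ
  ncard_eq : ∀ e ∈ H.edgeSet, e.ncard = 3

/-- `H ≤ G`: `G` contains `H` as a (not necessarily induced) subgraph, up to isomorphism. -/
def ContainsCopy {V W : Type} (H : Hypergraph V) (G : Hypergraph W) : Prop :=
  ∃ φ : V → W, Set.InjOn φ H.vertexSet ∧ Set.MapsTo φ H.vertexSet G.vertexSet ∧
    ∀ e ∈ H.edgeSet, φ '' e ∈ G.edgeSet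

/-- The possible edges of a 3-uniform hypergraph on `n` vertices; they index the input bits. -/
abbrev Triple (n : ℕ) : Type := {s : Finset (Fin n) // s.card = 3}

/-- The 3-uniform hypergraph on `n` vertices whose edges are the triples `s` with `x s` true. -/
def hypergraphOfInput {n : ℕ} (x : Triple n → Bool) : Hypergraph (Fin n) where
  vertexSet := Set.univ
  edgeSet := {e | ∃ s : Triple n, x s = true ∧ e = (s.1 : Set (Fin n))}
  subset_vertexSet_of_mem_edgeSet' := fun _ _ => Set.subset_univ _

open Classical in
/-- The Boolean function `f_H`: does the input hypergraph contain `H`? -/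
noncomputable def subgraphIsoFunction {n : ℕ} (H : Hypergraph (Fin n)) :
    (Triple n → Bool) → Bool :=
  fun x => decide (ContainsCopy H (hypergraphOfInput x))

/-! ## The weighted adversary bound -/

/-! The proof gives a linear bound, at least `n / 13000` queries, which is stronger than the
exponent 4/5. Write `q` for the number of queries.

Every bound comes from the weighted adversary method (`adversary_bound`) through one consequence,
`assignment_bound`. Some sites carry classes and `u` sites are free; `f` is false for every
rearrangement of this assignment, but becomes true as soon as any free site receives an active
class. If a bit can reveal only one (site, class) pair, then `u * ∑ (m a + 1) ≤ 1600 * q ^ 2`, where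
`m a` counts the sites of class `a`.

For graphs this yields `clique_bound`. Let `r` be least such that a clique on `r` vertices, joined
to `β` independent vertices, is accepted. Take `r - 1` clique vertices joined to `6β` independent
ones. If this graph is accepted, acceptance starts at some number of independent vertices between
`β` and `6β`, and finding the last one is hard (`join_bound`). If it is rejected, adding any star
with `β` leaves inside the independent part makes it accepted. A greedy forest of stars to which no
leaf can be added then has total weight between `β` and `2β`, and still leaves `3β` leaves free
(`star_bound`).

For hypergraphs, fix a symmetric family of triples and let the link of one vertex vary: this is a
graph property (`link_bound`). Let `E` be the edge set of `H` and `N` its set of non-isolated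
vertices. Hiding one edge gives `|E| ≤ 1600 * q ^ 2`. If `u` has minimum degree in `N`, the complete
hypergraph on `N \ {u}` has too few vertices to contain `H`, but a clique on at most `2 * deg u`
vertices in the link of `u` completes a copy. Either this clique is small and `clique_bound`
applies, or `|N| ^ 2` is of order at most `|E|`; in both cases `|N| = O(q)`. If instead `|N| ≤ n /
16`, take a smallest `T` such that the triples meeting `T` contain `H`, and remove a vertex `v` of
it; a clique on at most `|N|` vertices in the link of `v` restores a copy, so `n = O(q)`. -/

namespace QueryAlgorithm

variable {ι : Type}

/-- The sum of `‖ψ b‖ ^ 2` over the basis states that query the bit `i`. -/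
noncomputable def queryMass {k : ℕ} (ψ : QueryBasis ι k → ℂ) (i : Option ι) : ℝ :=
  ∑ p : (Fin k → Bool) × Bool, ‖ψ (i, p)‖ ^ 2

theorem queryMass_nonneg {k : ℕ} (ψ : QueryBasis ι k → ℂ) (i : Option ι) : 0 ≤ queryMass ψ i :=
  Finset.sum_nonneg fun _ _ => by positivity

theorem queryOracle_apply {k : ℕ} (x : ι → Bool) (ψ : QueryBasis ι k → ℂ) (i : Option ι)
    (p : (Fin k → Bool) × Bool) :
    queryOracle x ψ (i, p) = (if ∃ j, i = some j ∧ x j = true then -1 else 1) * ψ (i, p) := by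
  rcases i with _ | i
  · simp [queryOracle]
  · by_cases h : x i = true <;> simp [queryOracle, h]

variable [Fintype ι]

theorem sum_norm_sq_queryOracle {k : ℕ} (x : ι → Bool) (ψ : QueryBasis ι k → ℂ) :
    ∑ b, ‖queryOracle x ψ b‖ ^ 2 = ∑ b, ‖ψ b‖ ^ 2 := by
  refine Finset.sum_congr rfl fun b _ => ?_
  obtain ⟨i, p⟩ := b
  rw [queryOracle_apply]
  split_ifs <;> simp

/-- How much one query changes the inner product of two states. -/
theorem norm_dotProduct_sub_queryOracle_le {k : ℕ} (x y : ι → Bool) (φ ψ : QueryBasis ι k → ℂ)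
    (a b : ι → ℝ) (ha : ∀ i, 0 ≤ a i) (hb : ∀ i, 0 ≤ b i)
    (hab : ∀ i, x i ≠ y i → 1 ≤ a i * b i) :
    ‖star φ ⬝ᵥ ψ - star (queryOracle x φ) ⬝ᵥ queryOracle y ψ‖ ≤
      ∑ i, if x i ≠ y i then
        a i * queryMass φ (some i) + b i * queryMass ψ (some i) else 0 := by
  -- The two phases cancel unless the queried bit differs; there the product changes sign, which
  -- costs twice the original term.
  have key : star φ ⬝ᵥ ψ - star (queryOracle x φ) ⬝ᵥ queryOracle y ψ =
      ∑ i, ∑ p, if x i ≠ y i then 2 * (star (φ (some i, p)) * ψ (some i, p)) else 0 := by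
    simp only [dotProduct, ← Finset.sum_sub_distrib]
    rw [Fintype.sum_prod_type, Fintype.sum_option]
    have h0 : ∑ p, (star φ (none, p) * ψ (none, p) -
        star (queryOracle x φ) (none, p) * queryOracle y ψ (none, p)) = 0 :=
      Finset.sum_eq_zero fun p _ => by simp [queryOracle_apply]
    rw [h0, zero_add]
    refine Finset.sum_congr rfl fun i _ => Finset.sum_congr rfl fun p _ => ?_
    simp only [Pi.star_apply, queryOracle_apply]
    cases hx : x i <;> cases hy : y i <;> simp [hx, hy] <;> ring
  rw [key]
  refine (norm_sum_le _ _).trans (Finset.sum_le_sum fun i _ => ?_)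
  split_ifs with h
  · refine (norm_sum_le _ _).trans ?_
    rw [queryMass, queryMass, Finset.mul_sum, Finset.mul_sum, ← Finset.sum_add_distrib]
    refine Finset.sum_le_sum fun p _ => ?_
    rw [norm_mul, norm_mul, norm_star]
    have h1 := hab i h
    set r := ‖φ (some i, p)‖
    set s := ‖ψ (some i, p)‖
    have hr : 0 ≤ r := norm_nonneg _
    have hs : 0 ≤ s := norm_nonneg _
    -- Weighted AM-GM, using `a i * b i ≥ 1`.
    have h2 : (2 * (r * s)) ^ 2 ≤ (a i * r ^ 2 + b i * s ^ 2) ^ 2 := by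
      nlinarith [sq_nonneg (a i * r ^ 2 - b i * s ^ 2), mul_nonneg (sq_nonneg r) (sq_nonneg s),
        mul_le_mul_of_nonneg_left h1 (mul_nonneg (sq_nonneg r) (sq_nonneg s))]
    have h3 : 0 ≤ a i * r ^ 2 + b i * s ^ 2 :=
      add_nonneg (mul_nonneg (ha i) (sq_nonneg _)) (mul_nonneg (hb i) (sq_nonneg _))
    simpa using le_of_abs_le (abs_le_of_sq_le_sq h2 h3)
  · simp

variable [DecidableEq ι]

theorem star_dotProduct_self {κ : Type} [Fintype κ] (ψ : κ → ℂ) :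
    star ψ ⬝ᵥ ψ = ((∑ b, ‖ψ b‖ ^ 2 : ℝ) : ℂ) := by
  simp only [dotProduct, Pi.star_apply, RCLike.star_def, Complex.conj_mul']
  push_cast
  rfl

theorem star_mulVec_dotProduct_mulVec {κ : Type} [Fintype κ] [DecidableEq κ]
    (U : Matrix.unitaryGroup κ ℂ) (φ ψ : κ → ℂ) :
    star (U.1.mulVec φ) ⬝ᵥ U.1.mulVec ψ = star φ ⬝ᵥ ψ := by
  rw [Matrix.star_mulVec, Matrix.dotProduct_mulVec, Matrix.vecMul_vecMul]
  have h : U.1.conjTranspose * U.1 = 1 := Matrix.mem_unitaryGroup_iff'.1 U.2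
  rw [h, Matrix.vecMul_one]

theorem sum_norm_sq_mulVec {κ : Type} [Fintype κ] [DecidableEq κ]
    (U : Matrix.unitaryGroup κ ℂ) (ψ : κ → ℂ) :
    ∑ b, ‖U.1.mulVec ψ b‖ ^ 2 = ∑ b, ‖ψ b‖ ^ 2 := by
  have h := star_mulVec_dotProduct_mulVec U ψ ψ
  rw [star_dotProduct_self, star_dotProduct_self] at h
  exact_mod_cast h

theorem sum_norm_sq_state (A : QueryAlgorithm ι) (x : ι → Bool) (t : ℕ) :
    ∑ b, ‖A.state x t b‖ ^ 2 = 1 := by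
  induction t with
  | zero =>
    rw [state, sum_norm_sq_mulVec, Finset.sum_eq_single (none, fun _ => false, false)]
    · simp
    · intro b _ hb
      simp [Pi.single_eq_of_ne hb]
    · simp
  | succ t ih => rw [state, sum_norm_sq_mulVec, sum_norm_sq_queryOracle, ih]

theorem sum_queryMass_state_le (A : QueryAlgorithm ι) (x : ι → Bool) (t : ℕ) :
    ∑ i, queryMass (A.state x t) (some i) ≤ 1 := by
  have h := A.sum_norm_sq_state x t
  rw [Fintype.sum_prod_type, Fintype.sum_option] at h
  have h0 := queryMass_nonneg (A.state x t) none
  unfold queryMass at *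
  linarith

/-- The final states on inputs with different values of `f` are far from parallel. -/
theorem norm_dotProduct_state_le (A : QueryAlgorithm ι) {f : (ι → Bool) → Bool}
    (hA : A.Computes f) {x y : ι → Bool} (hx : f x = true) (hy : f y = false) :
    ‖star (A.state x A.queries) ⬝ᵥ A.state y A.queries‖ ≤ 943 / 1000 := by
  have hpx := hA x
  have hpy := hA y
  rw [hx] at hpx
  rw [hy] at hpy
  have total : ∀ z, A.outputProb z true + A.outputProb z false = 1 := by
    intro z
    rw [← A.sum_norm_sq_state z A.queries, Fintype.sum_prod_type, outputProb, outputProb,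
      ← Finset.sum_add_distrib]
    refine Finset.sum_congr rfl fun i _ => ?_
    rw [Fintype.sum_prod_type, ← Finset.sum_add_distrib]
    refine Finset.sum_congr rfl fun w _ => ?_
    rw [Fintype.sum_bool]
  have tx := total x
  have ty := total y
  -- AM-GM with `4 * (7 / 20) * (5 / 7) = 1`. The ratio 7/10 approximates `1 / √2`, the optimal one
  -- at error 1/3, so the result is just above the sharp value `2 * √2 / 3`.
  have bound : ‖star (A.state x A.queries) ⬝ᵥ A.state y A.queries‖ ≤
      (7 / 20 * A.outputProb x true + 5 / 7 * A.outputProb y true) +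
      (5 / 7 * A.outputProb x false + 7 / 20 * A.outputProb y false) := by
    rw [dotProduct, Fintype.sum_prod_type]
    simp only [outputProb, Finset.mul_sum, ← Finset.sum_add_distrib]
    refine (norm_sum_le _ _).trans (Finset.sum_le_sum fun i _ => ?_)
    rw [Fintype.sum_prod_type]
    refine (norm_sum_le _ _).trans (Finset.sum_le_sum fun w _ => ?_)
    rw [Fintype.sum_bool]
    refine (norm_add_le _ _).trans (add_le_add ?_ ?_)
    · rw [norm_mul, Pi.star_apply, norm_star]
      nlinarith [sq_nonneg (7 * ‖A.state x A.queries (i, w, true)‖ -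
        10 * ‖A.state y A.queries (i, w, true)‖)]
    · rw [norm_mul, Pi.star_apply, norm_star]
      nlinarith [sq_nonneg (10 * ‖A.state x A.queries (i, w, false)‖ -
        7 * ‖A.state y A.queries (i, w, false)‖)]
  linarith

/-- Ambainis' weighted adversary bound. -/
theorem adversary_bound (A : QueryAlgorithm ι) {f : (ι → Bool) → Bool} (hA : A.Computes f)
    {I J : Type} [Fintype I] [Fintype J] (X : I → ι → Bool) (Y : J → ι → Bool)
    (w : I → J → ℝ) (hw : ∀ i j, 0 ≤ w i j)
    (hX : ∀ i j, 0 < w i j → f (X i) = true) (hY : ∀ i j, 0 < w i j → f (Y j) = false)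
    {K : ℝ} (hK : 0 < K)
    (h : ∀ i j k, 0 < w i j → X i k ≠ Y j k →
      K * ((∑ j', if X i k ≠ Y j' k then w i j' else 0) *
        ∑ i', if X i' k ≠ Y j k then w i' j else 0) ≤ (∑ j', w i j') * ∑ i', w i' j)
    (hpos : 0 < ∑ i, ∑ j, w i j) :
    K ≤ 1600 * (A.queries : ℝ) ^ 2 := by
  set W := ∑ i, ∑ j, w i j with hW
  set wtX : I → ℝ := fun i => ∑ j, w i j with hwtX
  set wtY : J → ℝ := fun j => ∑ i, w i j with hwtY
  set vX : I → ι → ℝ := fun i k => ∑ j, if X i k ≠ Y j k then w i j else 0 with hvX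
  set vY : J → ι → ℝ := fun j k => ∑ i, if X i k ≠ Y j k then w i j else 0 with hvY
  have hite : ∀ i j k, 0 ≤ if X i k ≠ Y j k then w i j else 0 := fun i j k => by
    split_ifs
    exacts [hw i j, le_rfl]
  have wtX0 : ∀ i, 0 ≤ wtX i := fun i => Finset.sum_nonneg fun j _ => hw i j
  have wtY0 : ∀ j, 0 ≤ wtY j := fun j => Finset.sum_nonneg fun i _ => hw i j
  have vX0 : ∀ i k, 0 ≤ vX i k := fun i k => Finset.sum_nonneg fun j _ => hite i j k
  have vY0 : ∀ j k, 0 ≤ vY j k := fun j k => Finset.sum_nonneg fun i _ => hite i j k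
  have hsK : 0 < √K := Real.sqrt_pos.2 hK
  -- These AM-GM weights are chosen so that `a * b ≥ 1` is exactly the hypothesis `h`, while
  -- averaging over neighbours leaves `wtX / √K` and `wtY / √K`. If `vX` or `vY` vanishes the
  -- quotient is 0, which is harmless.
  set a : I → ι → ℝ := fun i k => wtX i / (√K * vX i k) with ha
  set b : J → ι → ℝ := fun j k => wtY j / (√K * vY j k) with hb
  have a0 : ∀ i k, 0 ≤ a i k := fun i k => div_nonneg (wtX0 i) (mul_nonneg hsK.le (vX0 i k))
  have b0 : ∀ j k, 0 ≤ b j k := fun j k => div_nonneg (wtY0 j) (mul_nonneg hsK.le (vY0 j k))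
  have hab : ∀ i j, 0 < w i j → ∀ k, X i k ≠ Y j k → 1 ≤ a i k * b j k := by
    intro i j hij k hk
    have h1 : 0 < vX i k := by
      refine lt_of_lt_of_le ?_ (Finset.single_le_sum (fun j _ => hite i j k) (Finset.mem_univ j))
      simpa [hk] using hij
    have h2 : 0 < vY j k := by
      refine lt_of_lt_of_le ?_ (Finset.single_le_sum (fun i _ => hite i j k) (Finset.mem_univ i))
      simpa [hk] using hij
    have h3 := h i j k hij hk
    rw [ha, hb]
    simp only
    rw [div_mul_div_comm, one_le_div (by positivity)]
    calc √K * vX i k * (√K * vY j k) = (√K * √K) * (vX i k * vY j k) := by ring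
      _ = K * (vX i k * vY j k) := by rw [Real.mul_self_sqrt hK.le]
      _ ≤ _ := h3
  have av : ∀ i k, a i k * vX i k ≤ wtX i / √K := by
    intro i k
    rcases (vX0 i k).eq_or_lt with h0 | h0
    · rw [← h0, mul_zero]
      exact div_nonneg (wtX0 i) hsK.le
    · rw [ha]
      simp only
      rw [div_mul_eq_mul_div, mul_comm (√K), mul_comm (wtX i), mul_div_mul_left _ _ h0.ne']
  have bv : ∀ j k, b j k * vY j k ≤ wtY j / √K := by
    intro j k
    rcases (vY0 j k).eq_or_lt with h0 | h0
    · rw [← h0, mul_zero]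
      exact div_nonneg (wtY0 j) hsK.le
    · rw [hb]
      simp only
      rw [div_mul_eq_mul_div, mul_comm (√K), mul_comm (wtY j), mul_div_mul_left _ _ h0.ne']
  have hWY : W = ∑ j, wtY j := Finset.sum_comm
  set ip : ℕ → I → J → ℂ := fun t i j => star (A.state (X i) t) ⬝ᵥ A.state (Y j) t with hip
  -- One query moves the weighted inner products by at most `2 * W / √K` in total. They all start at
  -- 1 and must each move by at least `57 / 1000 = 1 - 943 / 1000` wherever the weight is positive.
  have step : ∀ t, ∑ i, ∑ j, w i j * ‖ip t i j - ip (t + 1) i j‖ ≤ 2 * W / √K := by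
    intro t
    set α : I → ι → ℝ := fun i k => queryMass (A.state (X i) t) (some k) with hα
    set β : J → ι → ℝ := fun j k => queryMass (A.state (Y j) t) (some k) with hβ
    have α0 : ∀ i k, 0 ≤ α i k := fun i k => queryMass_nonneg _ _
    have β0 : ∀ j k, 0 ≤ β j k := fun j k => queryMass_nonneg _ _
    have h1 : ∀ i j, w i j * ‖ip t i j - ip (t + 1) i j‖ ≤
        ∑ k, ((if X i k ≠ Y j k then w i j else 0) * (a i k * α i k) +
          (if X i k ≠ Y j k then w i j else 0) * (b j k * β j k)) := by
      intro i j
      rcases (hw i j).eq_or_lt with h0 | h0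
      · simp [← h0]
      · have := norm_dotProduct_sub_queryOracle_le (X i) (Y j) (A.state (X i) t)
          (A.state (Y j) t) (a i) (b j) (a0 i) (b0 j) (hab i j h0)
        rw [hip]
        simp only [state, star_mulVec_dotProduct_mulVec]
        refine (mul_le_mul_of_nonneg_left this h0.le).trans_eq ?_
        rw [Finset.mul_sum]
        refine Finset.sum_congr rfl fun k _ => ?_
        split_ifs <;> ring
    have hx : ∑ i, ∑ j, ∑ k, (if X i k ≠ Y j k then w i j else 0) * (a i k * α i k) ≤ W / √K := by
      rw [hW, Finset.sum_div]
      refine Finset.sum_le_sum fun i _ => ?_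
      rw [Finset.sum_comm]
      calc ∑ k, ∑ j, (if X i k ≠ Y j k then w i j else 0) * (a i k * α i k)
          = ∑ k, a i k * vX i k * α i k := by
            refine Finset.sum_congr rfl fun k _ => ?_
            rw [← Finset.sum_mul]
            simp only [hvX]
            ring
        _ ≤ ∑ k, wtX i / √K * α i k :=
            Finset.sum_le_sum fun k _ => mul_le_mul_of_nonneg_right (av i k) (α0 i k)
        _ = wtX i / √K * ∑ k, α i k := by rw [Finset.mul_sum]
        _ ≤ wtX i / √K * 1 := mul_le_mul_of_nonneg_left (A.sum_queryMass_state_le _ _)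
            (div_nonneg (wtX0 i) hsK.le)
        _ = _ := mul_one _
    have hy : ∑ i, ∑ j, ∑ k, (if X i k ≠ Y j k then w i j else 0) * (b j k * β j k) ≤ W / √K := by
      rw [hWY, Finset.sum_div, Finset.sum_comm]
      refine Finset.sum_le_sum fun j _ => ?_
      rw [Finset.sum_comm]
      calc ∑ k, ∑ i, (if X i k ≠ Y j k then w i j else 0) * (b j k * β j k)
          = ∑ k, b j k * vY j k * β j k := by
            refine Finset.sum_congr rfl fun k _ => ?_
            rw [← Finset.sum_mul]
            simp only [hvY]
            ring
        _ ≤ ∑ k, wtY j / √K * β j k :=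
            Finset.sum_le_sum fun k _ => mul_le_mul_of_nonneg_right (bv j k) (β0 j k)
        _ = wtY j / √K * ∑ k, β j k := by rw [Finset.mul_sum]
        _ ≤ wtY j / √K * 1 := mul_le_mul_of_nonneg_left (A.sum_queryMass_state_le _ _)
            (div_nonneg (wtY0 j) hsK.le)
        _ = _ := mul_one _
    calc ∑ i, ∑ j, w i j * ‖ip t i j - ip (t + 1) i j‖
        ≤ ∑ i, ∑ j, ∑ k, ((if X i k ≠ Y j k then w i j else 0) * (a i k * α i k) +
          (if X i k ≠ Y j k then w i j else 0) * (b j k * β j k)) :=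
          Finset.sum_le_sum fun i _ => Finset.sum_le_sum fun j _ => h1 i j
      _ = ∑ i, ∑ j, ∑ k, (if X i k ≠ Y j k then w i j else 0) * (a i k * α i k) +
          ∑ i, ∑ j, ∑ k, (if X i k ≠ Y j k then w i j else 0) * (b j k * β j k) := by
          simp only [Finset.sum_add_distrib]
      _ ≤ W / √K + W / √K := add_le_add hx hy
      _ = _ := by ring
  have total : ∀ t : ℕ, ∑ i, ∑ j, w i j * ‖ip 0 i j - ip t i j‖ ≤ t * (2 * W / √K) := by
    intro t
    induction t with
    | zero => simp
    | succ t ih =>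
      have h1 : ∑ i, ∑ j, w i j * ‖ip 0 i j - ip (t + 1) i j‖ ≤
          ∑ i, ∑ j, (w i j * ‖ip 0 i j - ip t i j‖ + w i j * ‖ip t i j - ip (t + 1) i j‖) := by
        refine Finset.sum_le_sum fun i _ => Finset.sum_le_sum fun j _ => ?_
        rw [← mul_add]
        refine mul_le_mul_of_nonneg_left ?_ (hw i j)
        exact (congrArg norm (sub_add_sub_cancel _ _ _).symm).trans_le (norm_add_le _ _)
      simp only [Finset.sum_add_distrib] at h1
      push_cast
      have := step t
      linarith
  have init : ∀ i j, ip 0 i j = 1 := by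
    intro i j
    rw [hip]
    simp only [state, star_mulVec_dotProduct_mulVec]
    rw [star_dotProduct_self, Finset.sum_eq_single (none, fun _ => false, false)]
    · simp
    · intro b _ hb
      simp [Pi.single_eq_of_ne hb]
    · simp
  have lower : 57 / 1000 * W ≤ ∑ i, ∑ j, w i j * ‖ip 0 i j - ip A.queries i j‖ := by
    rw [hW, Finset.mul_sum]
    refine Finset.sum_le_sum fun i _ => ?_
    rw [Finset.mul_sum]
    refine Finset.sum_le_sum fun j _ => ?_
    rcases (hw i j).eq_or_lt with h0 | h0
    · simp [← h0]
    · rw [mul_comm]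
      refine mul_le_mul_of_nonneg_left ?_ h0.le
      have h1 : ‖ip A.queries i j‖ ≤ 943 / 1000 :=
        A.norm_dotProduct_state_le hA (hX i j h0) (hY i j h0)
      have h2 := norm_sub_norm_le (ip 0 i j) (ip A.queries i j)
      rw [init] at h2 ⊢
      rw [norm_one] at h2
      linarith
  have h1 := lower.trans (total A.queries)
  have h2 : 57 / 1000 * √K ≤ A.queries * 2 := by
    have h3 : (A.queries : ℝ) * (2 * W / √K) = (A.queries * 2) * W / √K := by ring
    rw [h3, le_div_iff₀ hsK] at h1
    have h4 : W * (57 / 1000 * √K) ≤ W * (A.queries * 2) := by linarith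
    exact le_of_mul_le_mul_left h4 hpos
  have h3 : √K ≤ 40 * A.queries := by
    have : (0 : ℝ) ≤ A.queries := Nat.cast_nonneg _
    linarith
  calc K = √K ^ 2 := (Real.sq_sqrt hK.le).symm
    _ ≤ (40 * A.queries) ^ 2 := pow_le_pow_left₀ hsK.le h3 2
    _ = _ := by ring

end QueryAlgorithm

/-! ## Hidden assignments -/

namespace QueryAlgorithm

open Function in
/-- Among all rearrangements of a partial assignment `ℓ₀` of the sites `L` to the classes `κ`, it is
hard to notice that one more site has been assigned to an active class. -/
theorem assignment_bound {ι L κ : Type} [Fintype ι] [DecidableEq ι] [Fintype L] [DecidableEq L]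
    [Fintype κ] [DecidableEq κ] (A : QueryAlgorithm ι) {f : (ι → Bool) → Bool} (hA : A.Computes f)
    (F : (L → Option κ) → ι → Bool) (active : Finset κ) (ℓ₀ : L → Option κ)
    (hfalse : ∀ σ : Equiv.Perm L, f (F (ℓ₀ ∘ σ)) = false)
    (htrue : ∀ a ∈ active, ∀ (σ : Equiv.Perm L) (z : L), ℓ₀ (σ z) = none →
      f (F (update (ℓ₀ ∘ σ) z (some a))) = true)
    (huniq : ∀ (k : ι) (ℓ ℓ' : L → Option κ) (z z' : L), ∀ a ∈ active, ∀ a' ∈ active,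
      ℓ z = none → ℓ' z' = none → F (update ℓ z (some a)) k ≠ F ℓ k →
      F (update ℓ' z' (some a')) k ≠ F ℓ' k → z = z' ∧ a = a') :
    (Finset.univ.filter fun z => ℓ₀ z = none).card *
      ∑ a ∈ active, ((Finset.univ.filter fun z => ℓ₀ z = some a).card + 1) ≤
      1600 * A.queries ^ 2 := by
  classical
  set U := (Finset.univ.filter fun z => ℓ₀ z = none).card with hU
  set m : κ → ℕ := fun a => (Finset.univ.filter fun z => ℓ₀ z = some a).card with hm
  set S := ∑ a ∈ active, (m a + 1) with hS
  rcases Nat.eq_zero_or_pos (U * S) with h0 | hUS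
  · rw [h0]
    exact Nat.zero_le _
  have hUpos : 0 < U := Nat.pos_of_mul_pos_right hUS
  have hSpos : 0 < S := Nat.pos_of_mul_pos_left hUS
  let Same : (L → Option κ) → Prop := fun ℓ => ∃ σ : Equiv.Perm L, ℓ = ℓ₀ ∘ σ
  have card_same : ∀ ℓ, Same ℓ → ∀ c, (Finset.univ.filter fun z => ℓ z = c).card =
      (Finset.univ.filter fun z => ℓ₀ z = c).card := by
    rintro ℓ ⟨σ, rfl⟩ c
    refine Finset.card_bij (fun z _ => σ z) ?_ (fun _ _ _ _ h => σ.injective h) ?_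
    · intro z hz
      simpa using hz
    · intro z hz
      exact ⟨σ.symm z, by simpa using hz, by simp⟩
  let Rel : κ × (L → Option κ) → (L → Option κ) → Prop := fun i ℓ =>
    i.1 ∈ active ∧ Same ℓ ∧ ∃ z, ℓ z = none ∧ i.2 = update ℓ z (some i.1)
  -- With weight `m a + 1`, a true input has `m a + 1` neighbours (free any site of class `a`),
  -- hence total weight `(m a + 1) ^ 2`; a false input has total weight `U * S`. A bit distinguishes
  -- an input from at most one neighbour on either side, so the factors `m a + 1` cancel and `K = U
  -- * S`.
  let w : κ × (L → Option κ) → (L → Option κ) → ℝ := fun i ℓ =>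
    if Rel i ℓ then ((m i.1 + 1 : ℕ) : ℝ) else 0
  have hw : ∀ i j, 0 ≤ w i j := fun i j => by
    simp only [w]
    split_ifs
    exacts [Nat.cast_nonneg _, le_rfl]
  have hrel : ∀ i j, 0 < w i j → Rel i j := fun i j h => by
    by_contra h'
    simp [w, h'] at h
  have hwle : ∀ i j, w i j ≤ ((m i.1 + 1 : ℕ) : ℝ) := fun i j => by
    simp only [w]
    split_ifs
    exacts [le_rfl, Nat.cast_nonneg _]
  have erase : ∀ (ℓ : L → Option κ) (z : L) (a : κ), ℓ z = none → update (update ℓ z (some a)) z none = ℓ := by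
    intro ℓ z a hz
    rw [update_idem, ← hz, update_eq_self]
  have wtX : ∀ i j, Rel i j → ((m i.1 + 1 : ℕ) : ℝ) * ((m i.1 + 1 : ℕ) : ℝ) ≤ ∑ j', w i j' := by
    rintro ⟨a, x⟩ ℓ ⟨ha, hs, z, hz, hx⟩
    simp only at ha hx ⊢
    have hcard : (Finset.univ.filter fun z' => x z' = some a).card = m a + 1 := by
      have : (Finset.univ.filter fun z' => x z' = some a) =
          insert z (Finset.univ.filter fun z' => ℓ z' = some a) := by
        ext z'
        by_cases h : z' = z
        · subst h
          simp [hx]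
        · simp [hx, h]
      rw [this, Finset.card_insert_of_notMem (by simp [hz]), card_same ℓ hs]
    have hinj : Set.InjOn (fun z' => update x z' none)
        (Finset.univ.filter fun z' => x z' = some a : Finset L) := by
      intro z₁ h₁ z₂ h₂ h
      by_contra hne
      have h3 := congrFun h z₁
      simp only [update_self, update_of_ne hne] at h3
      simp [← h3] at h₁
    have hval : ∀ z' ∈ Finset.univ.filter fun z' => x z' = some a,
        w (a, x) (update x z' none) = ((m a + 1 : ℕ) : ℝ) := by
      intro z' hz'
      have hz' : x z' = some a := by simpa using hz'
      have : Rel (a, x) (update x z' none) := by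
        refine ⟨ha, ?_, z', by simp, ?_⟩
        · obtain ⟨σ, rfl⟩ := hs
          -- Freeing `z'` instead of `z` amounts to swapping these two sites.
          refine ⟨(Equiv.swap z z').trans σ, ?_⟩
          have h1 : ∀ y, ((ℓ₀ ∘ ((Equiv.swap z z').trans σ)) y) =
            (ℓ₀ ∘ σ) (Equiv.swap z z' y) := fun y => rfl
          funext y
          rw [h1]
          by_cases hzz : z' = z
          · subst hzz
            rw [hx, erase _ _ _ hz]
            simp
          · have hz'' : (ℓ₀ ∘ σ) z' = some a := by
              rw [hx, update_of_ne hzz] at hz'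
              exact hz'
            by_cases hy : y = z'
            · subst hy
              rw [Equiv.swap_apply_right, update_self, hz]
            · rw [update_of_ne hy, hx]
              by_cases hy' : y = z
              · subst hy'
                rw [Equiv.swap_apply_left, update_self, hz'']
              · rw [update_of_ne hy', Equiv.swap_apply_of_ne_of_ne hy' hy]
        · simp only
          rw [update_idem, ← hz', update_eq_self]
      simp only [w, if_pos this]
    calc ((m a + 1 : ℕ) : ℝ) * ((m a + 1 : ℕ) : ℝ)
        = ∑ z' ∈ Finset.univ.filter fun z' => x z' = some a, w (a, x) (update x z' none) := by
          rw [Finset.sum_congr rfl hval, Finset.sum_const, hcard, nsmul_eq_mul]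
      _ = ∑ j' ∈ (Finset.univ.filter fun z' => x z' = some a).image
            (fun z' => update x z' none), w (a, x) j' := (Finset.sum_image hinj).symm
      _ ≤ _ := Finset.sum_le_sum_of_subset_of_nonneg (Finset.subset_univ _) fun j _ _ => hw _ j
  have wtY : ∀ ℓ, Same ℓ → ((U * S : ℕ) : ℝ) ≤ ∑ i, w i ℓ := by
    intro ℓ hs
    set T := active ×ˢ Finset.univ.filter fun z => ℓ z = none with hT
    have hinj : Set.InjOn (fun p : κ × L => (p.1, update ℓ p.2 (some p.1))) (T : Set (κ × L)) := by
      rintro ⟨a₁, z₁⟩ h₁ ⟨a₂, z₂⟩ h₂ h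
      simp only [Prod.mk.injEq] at h
      obtain ⟨rfl, h⟩ := h
      by_contra hne
      have hne' : z₁ ≠ z₂ := fun h => hne (by rw [h])
      have h3 := congrFun h z₁
      rw [update_self, update_of_ne hne'] at h3
      simp [hT, ← h3] at h₁
    have hval : ∀ p ∈ T, w (p.1, update ℓ p.2 (some p.1)) ℓ = ((m p.1 + 1 : ℕ) : ℝ) := by
      rintro ⟨a, z⟩ hp
      simp only [hT, Finset.mem_product, Finset.mem_filter, Finset.mem_univ, true_and] at hp
      exact if_pos ⟨hp.1, hs, z, hp.2, rfl⟩
    calc ((U * S : ℕ) : ℝ) = ∑ p ∈ T, w (p.1, update ℓ p.2 (some p.1)) ℓ := by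
          rw [Finset.sum_congr rfl hval, hT, Finset.sum_product]
          simp only [Finset.sum_const, nsmul_eq_mul]
          rw [card_same ℓ hs, ← Finset.mul_sum]
          push_cast
          rw [hS]
          push_cast
          rfl
      _ = ∑ i ∈ T.image fun p : κ × L => (p.1, update ℓ p.2 (some p.1)), w i ℓ :=
          (Finset.sum_image (f := fun i => w i ℓ) hinj).symm
      _ ≤ _ := Finset.sum_le_sum_of_subset_of_nonneg (Finset.subset_univ _) fun i _ _ => hw i _
  have bound := A.adversary_bound hA (I := κ × (L → Option κ)) (J := L → Option κ)
    (fun i => F i.2) F w hw ?_ ?_ (K := ((U * S : ℕ) : ℝ)) (by exact_mod_cast hUS) ?_ ?_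
  · exact_mod_cast bound
  · intro i j hij
    obtain ⟨ha, ⟨σ, rfl⟩, z, hz, hx⟩ := hrel i j hij
    simp only [hx]
    exact htrue _ ha σ z hz
  · intro i j hij
    obtain ⟨ha, ⟨σ, rfl⟩, z, hz, hx⟩ := hrel i j hij
    exact hfalse σ
  · rintro ⟨a, x⟩ ℓ k hij hk
    obtain ⟨ha, hs, z, hz, hx⟩ := hrel _ _ hij
    simp only at ha hx hk ⊢
    have hX : (∑ j', if F x k ≠ F j' k then w (a, x) j' else 0) ≤ ((m a + 1 : ℕ) : ℝ) := by
      rw [Finset.sum_eq_single ℓ]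
      · rw [if_pos hk]
        exact hwle _ _
      · intro ℓ' _ hne
        by_cases hd : F x k ≠ F ℓ' k
        · rw [if_pos hd]
          by_contra hpos
          obtain ⟨-, -, z', hz', hx'⟩ := hrel _ _ (lt_of_le_of_ne (hw _ _) (Ne.symm hpos))
          simp only at hx'
          have h1 := (huniq k ℓ ℓ' z z' a ha a ha hz hz' (by rw [← hx]; exact hk)
            (by rw [← hx']; exact hd)).1
          subst h1
          exact hne (by rw [← erase ℓ' z a hz', ← hx', hx, erase ℓ z a hz])
        · rw [if_neg hd]
      · simp
    have hY : (∑ i', if F i'.2 k ≠ F ℓ k then w i' ℓ else 0) ≤ ((m a + 1 : ℕ) : ℝ) := by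
      rw [Finset.sum_eq_single (a, x)]
      · rw [if_pos hk]
        exact hwle _ _
      · rintro ⟨a', x'⟩ _ hne
        by_cases hd : F x' k ≠ F ℓ k
        · rw [if_pos hd]
          by_contra hpos
          obtain ⟨ha', -, z', hz', hx'⟩ := hrel _ _ (lt_of_le_of_ne (hw _ _) (Ne.symm hpos))
          simp only at hx' ha'
          obtain ⟨rfl, rfl⟩ := huniq k ℓ ℓ z z' a ha a' ha' hz hz' (by rw [← hx]; exact hk)
            (by rw [← hx']; exact hd)
          exact hne (by rw [hx, hx'])
        · rw [if_neg hd]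
      · simp
    have hX0 : 0 ≤ ∑ j', if F x k ≠ F j' k then w (a, x) j' else 0 :=
      Finset.sum_nonneg fun j _ => by
        split_ifs
        exacts [hw _ _, le_rfl]
    have hY0 : 0 ≤ ∑ i', if F i'.2 k ≠ F ℓ k then w i' ℓ else 0 :=
      Finset.sum_nonneg fun j _ => by
        split_ifs
        exacts [hw _ _, le_rfl]
    have h1 := wtX (a, x) ℓ (hrel _ _ hij)
    have h2 := wtY ℓ hs
    simp only at h1
    calc _ ≤ ((U * S : ℕ) : ℝ) * (((m a + 1 : ℕ) : ℝ) * ((m a + 1 : ℕ) : ℝ)) :=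
          mul_le_mul_of_nonneg_left (mul_le_mul hX hY hY0 (Nat.cast_nonneg _)) (Nat.cast_nonneg _)
      _ = (((m a + 1 : ℕ) : ℝ) * ((m a + 1 : ℕ) : ℝ)) * ((U * S : ℕ) : ℝ) := mul_comm _ _
      _ ≤ _ := mul_le_mul h1 h2 (Nat.cast_nonneg _)
          (Finset.sum_nonneg fun j _ => hw _ _)
  · rw [Finset.sum_comm]
    refine lt_of_lt_of_le ?_ (Finset.single_le_sum
      (fun j _ => Finset.sum_nonneg fun i _ => hw i j) (Finset.mem_univ ℓ₀))
    refine lt_of_lt_of_le ?_ (wtY ℓ₀ ⟨1, by simp⟩)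
    exact_mod_cast hUS

end QueryAlgorithm

/-! ## Monotone graph properties that hold for a small clique -/

/-- The pairs of distinct elements of `D ∪ V` that meet `D`. -/
def joinPairs {α : Type} (D V : Set α) : Set (Sym2 α) :=
  {p | ∃ a ∈ D, ∃ b ∈ D ∪ V, a ≠ b ∧ p = s(a, b)}

theorem joinPairs_mono {α : Type} {D V D' V' : Set α} (h : D ⊆ D') (h' : D ∪ V ⊆ D' ∪ V') :
    joinPairs D V ⊆ joinPairs D' V' := by
  rintro p ⟨a, ha, b, hb, hab, rfl⟩
  exact ⟨a, h ha, b, h' hb, hab, rfl⟩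

theorem image_joinPairs {α : Type} (σ : Equiv.Perm α) (D V : Set α) :
    Sym2.map σ '' joinPairs D V = joinPairs (σ '' D) (σ '' V) := by
  ext p
  constructor
  · rintro ⟨_, ⟨a, ha, b, hb, hab, rfl⟩, rfl⟩
    refine ⟨σ a, ⟨a, ha, rfl⟩, σ b, ?_, fun h => hab (σ.injective h), by simp⟩
    rw [← Set.image_union]
    exact ⟨b, hb, rfl⟩
  · rintro ⟨_, ⟨a, ha, rfl⟩, y, hy, hab, rfl⟩
    rw [← Set.image_union] at hy
    obtain ⟨b, hb, rfl⟩ := hy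
    exact ⟨s(a, b), ⟨a, ha, b, hb, fun h => hab (by rw [h]), rfl⟩, by simp⟩

theorem exists_perm_image_eq {α : Type} [Fintype α] [DecidableEq α] {D V D' V' : Finset α}
    (h : Disjoint D V) (h' : Disjoint D' V') (hD : D.card = D'.card) (hV : V.card = V'.card) :
    ∃ σ : Equiv.Perm α, σ '' (D : Set α) = D' ∧ σ '' (V : Set α) = V' := by
  classical
  have e1 : Nonempty ({x // x ∈ D} ≃ {x // x ∈ D'}) :=
    ⟨Fintype.equivOfCardEq (by simpa using hD)⟩
  have e2 : Nonempty ({x // x ∈ V} ≃ {x // x ∈ V'}) :=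
    ⟨Fintype.equivOfCardEq (by simpa using hV)⟩
  -- The colouring by `D`, `V` and the rest: equal colour classes can be matched by bijections,
  -- which glue to a permutation.
  let c : Finset α → Finset α → α → Option Bool := fun D V x =>
    if x ∈ D then some true else if x ∈ V then some false else none
  have key : ∀ o, Fintype.card {x // c D V x = o} = Fintype.card {x // c D' V' x = o} := by
    have t1 : ∀ D V : Finset α, Fintype.card {x // c D V x = some true} = D.card := by
      intro D V
      rw [Fintype.card_subtype]
      congr 1
      ext x
      simp only [c, Finset.mem_filter, Finset.mem_univ, true_and]
      split_ifs <;> simp_all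
    have t2 : ∀ D V : Finset α, Disjoint D V →
        Fintype.card {x // c D V x = some false} = V.card := by
      intro D V hd
      rw [Fintype.card_subtype]
      congr 1
      ext x
      simp only [c, Finset.mem_filter, Finset.mem_univ, true_and]
      have : x ∈ D → x ∉ V := fun hx => Finset.disjoint_left.1 hd hx
      split_ifs <;> simp_all
    have t3 : ∀ D V : Finset α, Disjoint D V →
        Fintype.card {x // c D V x = none} = Fintype.card α - (D.card + V.card) := by
      intro D V hd
      rw [Fintype.card_subtype, ← Finset.card_union_of_disjoint hd, ← Finset.card_compl]
      congr 1
      ext x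
      simp only [c, Finset.mem_filter, Finset.mem_univ, true_and, Finset.mem_compl,
        Finset.mem_union]
      split_ifs <;> simp_all
    rintro (_ | _ | _)
    · rw [t3 _ _ h, t3 _ _ h', hD, hV]
    · rw [t2 _ _ h, t2 _ _ h', hV]
    · rw [t1, t1, hD]
  let σ : Equiv.Perm α := Equiv.ofFiberEquiv fun o => Fintype.equivOfCardEq (key o)
  have hσ : ∀ x, c D' V' (σ x) = c D V x := fun x => Equiv.ofFiberEquiv_map _ x
  have img : ∀ (E E' : Finset α), (∀ x, σ x ∈ E' ↔ x ∈ E) → σ '' (E : Set α) = E' := by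
    intro E E' hE
    ext y
    constructor
    · rintro ⟨x, hx, rfl⟩
      exact (hE x).2 hx
    · intro hy
      exact ⟨σ.symm y, (hE _).1 (by simpa using hy), by simp⟩
  refine ⟨σ, img _ _ fun x => ?_, img _ _ fun x => ?_⟩
  · have := hσ x
    simp only [c] at this
    split_ifs at this <;> simp_all
  · have := hσ x
    have d1 : x ∈ D → x ∉ V := fun hx => Finset.disjoint_left.1 h hx
    have d2 : σ x ∈ D' → σ x ∉ V' := fun hx => Finset.disjoint_left.1 h' hx
    simp only [c] at this
    split_ifs at this <;> simp_all

/-- `f` restricted to the inputs `enc Γ` is a monotone graph property of `Γ`, and a bit of `enc Γ`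
depends on at most one pair. -/
structure IsGraphProperty {ι α : Type} (f : (ι → Bool) → Bool) (enc : Set (Sym2 α) → ι → Bool)
    (pairOf : ι → Option (Sym2 α)) : Prop where
  enc_eq : ∀ Γ Γ' k, (∀ p, pairOf k = some p → (p ∈ Γ ↔ p ∈ Γ')) → enc Γ k = enc Γ' k
  mono : ∀ Γ Γ', Γ ⊆ Γ' → f (enc Γ) = true → f (enc Γ') = true
  symm : ∀ (σ : Equiv.Perm α) Γ, f (enc (Sym2.map σ '' Γ)) = f (enc Γ)

namespace IsGraphProperty

variable {ι α : Type} {f : (ι → Bool) → Bool}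
  {enc : Set (Sym2 α) → ι → Bool} {pairOf : ι → Option (Sym2 α)}

theorem pairOf_eq_of_ne (h : IsGraphProperty f enc pairOf) {Γ Γ' : Set (Sym2 α)} {k : ι}
    (hk : enc Γ k ≠ enc Γ' k) : ∃ p, pairOf k = some p ∧ ¬(p ∈ Γ ↔ p ∈ Γ') := by
  by_contra! h'
  exact hk (h.enc_eq _ _ _ h')

variable [Fintype α] [DecidableEq α]

theorem join_congr (h : IsGraphProperty f enc pairOf) {D V D' V' : Finset α}
    (hd : Disjoint D V) (hd' : Disjoint D' V') (hD : D.card = D'.card) (hV : V.card = V'.card) :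
    f (enc (joinPairs (D : Set α) V)) = f (enc (joinPairs (D' : Set α) V')) := by
  obtain ⟨σ, h1, h2⟩ := exists_perm_image_eq hd hd' hD hV
  rw [← h1, ← h2, ← image_joinPairs, h.symm]

variable [Fintype ι] [DecidableEq ι]

/-- An instance of `assignment_bound`: the sites are the vertices outside `D`, the single class is
membership in `V`. A bit affected by the new vertex reads a pair joining it to `D`, so it identifies
that vertex. -/
theorem join_bound (h : IsGraphProperty f enc pairOf) (A : QueryAlgorithm ι) (hA : A.Computes f)
    {D V : Finset α} {z : α} (hd : Disjoint D V) (hzD : z ∉ D) (hzV : z ∉ V)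
    (hV : f (enc (joinPairs (D : Set α) V)) = false)
    (hV' : f (enc (joinPairs (D : Set α) (insert z V : Finset α))) = true) :
    (Dᶜ.card - V.card) * (V.card + 1) ≤ 1600 * A.queries ^ 2 := by
  let L := {x : α // x ∉ D}
  let set : (L → Option Unit) → Finset α := fun ℓ =>
    (Finset.univ.filter fun x : L => ℓ x = some ()).map (Function.Embedding.subtype _)
  let ℓ₀ : L → Option Unit := fun x => if x.1 ∈ V then some () else none
  have mem_set : ∀ ℓ x, x ∈ set ℓ ↔ ∃ hx : x ∉ D, ℓ ⟨x, hx⟩ = some () := by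
    intro ℓ x
    simp [set, L]
  have disj : ∀ ℓ, Disjoint D (set ℓ) := by
    intro ℓ
    rw [Finset.disjoint_left]
    intro x hx hx'
    exact ((mem_set _ _).1 hx').1 hx
  have card_set : ∀ ℓ, (set ℓ).card = (Finset.univ.filter fun x : L => ℓ x = some ()).card :=
    fun ℓ => Finset.card_map _
  have set₀ : set ℓ₀ = V := by
    ext x
    rw [mem_set]
    constructor
    · intro hx
      by_contra h2
      simp [ℓ₀, h2] at hx
    · intro hx
      exact ⟨fun h1 => Finset.disjoint_left.1 hd h1 hx, by simp [ℓ₀, hx]⟩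
  have card_perm : ∀ σ : Equiv.Perm L, (set (ℓ₀ ∘ σ)).card = V.card := by
    intro σ
    rw [← set₀, card_set, card_set]
    refine Finset.card_bij (fun z _ => σ z) ?_ (fun _ _ _ _ h => σ.injective h) ?_
    · intro z hz
      simpa using hz
    · intro z hz
      exact ⟨σ.symm z, by simpa using hz, by simp⟩
  have set_update : ∀ (ℓ : L → Option Unit) (y : L), set (Function.update ℓ y (some ())) =
      insert y.1 (set ℓ) := by
    intro ℓ y
    ext x
    rw [Finset.mem_insert, mem_set, mem_set]
    by_cases hxy : x = y.1
    · subst hxy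
      simp [y.2]
    · have : ∀ hx : x ∉ D, (⟨x, hx⟩ : L) ≠ y := fun hx h' => hxy (by rw [← h'])
      simp only [hxy, false_or]
      refine exists_congr fun hx => ?_
      rw [Function.update_of_ne (this hx)]
  have notMem_set : ∀ (ℓ : L → Option Unit) (y : L), ℓ y = none → y.1 ∉ set ℓ := by
    intro ℓ y hy hy'
    obtain ⟨_, h1⟩ := (mem_set _ _).1 hy'
    simp [hy] at h1
  have bound := A.assignment_bound hA (fun ℓ => enc (joinPairs (D : Set α) (set ℓ)))
    Finset.univ ℓ₀ ?_ ?_ ?_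
  · have c1 : (Finset.univ.filter fun z => ℓ₀ z = some ()).card = V.card := by
      rw [← card_set, set₀]
    have c2 : (Finset.univ.filter fun z => ℓ₀ z = none).card = Dᶜ.card - V.card := by
      have : (Finset.univ.filter fun z => ℓ₀ z = none) =
          (Finset.univ.filter fun z => ℓ₀ z = some ())ᶜ := by
        ext x
        simp only [Finset.mem_filter, Finset.mem_univ, true_and, Finset.mem_compl]
        rcases ℓ₀ x with _ | _ <;> simp
      rw [this, Finset.card_compl, c1]
      congr 1
      rw [Fintype.card_subtype]
      congr 1
      ext x
      simp
    simpa [c1, c2] using bound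
  · intro σ
    rw [← hV]
    exact h.join_congr (disj _) hd rfl (card_perm σ)
  · rintro ⟨⟩ - σ y hy
    rw [← hV']
    refine h.join_congr (disj _) ?_ rfl ?_
    · rw [Finset.disjoint_insert_right]
      exact ⟨hzD, hd⟩
    · rw [set_update, Finset.card_insert_of_notMem (notMem_set (ℓ₀ ∘ σ) _ hy), card_perm,
        Finset.card_insert_of_notMem hzV]
  · rintro k ℓ ℓ' y y' ⟨⟩ - ⟨⟩ - hy hy' hk hk'
    have new : ∀ (ℓ : L → Option Unit) (y : L), ℓ y = none →
        enc (joinPairs (D : Set α) (set (Function.update ℓ y (some ())))) k ≠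
        enc (joinPairs (D : Set α) (set ℓ)) k → ∃ a ∈ D, pairOf k = some s(a, y.1) := by
      intro ℓ y hy hk
      obtain ⟨p, hp, hne⟩ := h.pairOf_eq_of_ne hk
      have sub : joinPairs (D : Set α) (set ℓ) ⊆
          joinPairs (D : Set α) (set (Function.update ℓ y (some ()))) := by
        refine joinPairs_mono subset_rfl (Set.union_subset_union_right _ ?_)
        rw [set_update]
        exact_mod_cast Finset.subset_insert _ _
      have h1 : p ∈ joinPairs (D : Set α) (set (Function.update ℓ y (some ()))) := by
        by_contra h1
        exact hne ⟨fun h2 => absurd h2 h1, fun h2 => sub h2⟩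
      have h2 : p ∉ joinPairs (D : Set α) (set ℓ) := fun h2 => hne ⟨fun _ => h2, fun _ => h1⟩
      obtain ⟨a, ha, b, hb, hab, rfl⟩ := h1
      have hby : b = y.1 := by
        by_contra hby
        refine h2 ⟨a, ha, b, ?_, hab, rfl⟩
        rw [set_update] at hb
        simpa [hby] using hb
      subst hby
      exact ⟨a, ha, hp⟩
    obtain ⟨a, ha, h1⟩ := new ℓ y hy hk
    obtain ⟨a', ha', h2⟩ := new ℓ' y' hy' hk'
    rw [h1, Option.some_inj, Sym2.eq_iff] at h2
    rcases h2 with h2 | h2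
    · exact ⟨Subtype.ext h2.2, rfl⟩
    · exact absurd (h2.2 ▸ ha') y.2

end IsGraphProperty

/-! ## Star forests -/

/-- The pairs `s(a, z)` such that `ℓ` assigns the leaf `z` to the center `a`. -/
def forestPairs {α : Type} {L : Finset α} (ℓ : L → Option α) : Set (Sym2 α) :=
  {p | ∃ (z : L) (a : α), ℓ z = some a ∧ p = s(a, z.1)}

/-- The pairs `s(c, z)` with `z ∈ V`. -/
def starPairs {α : Type} (c : α) (V : Set α) : Set (Sym2 α) :=
  {p | ∃ z ∈ V, p = s(c, z)}

theorem forestPairs_mono {α : Type} {L : Finset α} {ℓ ℓ' : L → Option α}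
    (h : ∀ z a, ℓ z = some a → ℓ' z = some a) : forestPairs ℓ ⊆ forestPairs ℓ' := by
  rintro p ⟨z, a, hz, rfl⟩
  exact ⟨z, a, h z a hz, rfl⟩

theorem forestPairs_update_mono {α : Type} [DecidableEq α] {L : Finset α} {ℓ ℓ' : L → Option α}
    (h : ∀ z a, ℓ z = some a → ℓ' z = some a) (y : L) (b : α) :
    forestPairs (Function.update ℓ y (some b)) ⊆ forestPairs (Function.update ℓ' y (some b)) := by
  refine forestPairs_mono fun z a hz => ?_
  by_cases hzy : z = y
  · subst hzy
    simpa using hz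
  · rw [Function.update_of_ne hzy] at hz ⊢
    exact h z a hz

theorem image_forestPairs {α : Type} [DecidableEq α] {L A : Finset α} (hAL : Disjoint A L)
    {ℓ : L → Option α} (hℓ : ∀ z a, ℓ z = some a → a ∈ A) (σ : Equiv.Perm L) :
    Sym2.map (Equiv.Perm.ofSubtype σ) '' forestPairs (ℓ ∘ σ) = forestPairs ℓ := by
  have hA : ∀ a ∈ A, Equiv.Perm.ofSubtype σ a = a := fun a ha =>
    Equiv.Perm.ofSubtype_apply_of_not_mem σ (Finset.disjoint_left.1 hAL ha)
  ext p
  constructor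
  · rintro ⟨_, ⟨z, a, hz, rfl⟩, rfl⟩
    refine ⟨σ z, a, hz, ?_⟩
    rw [Sym2.map_mk, hA a (hℓ _ _ hz), Equiv.Perm.ofSubtype_apply_coe]
  · rintro ⟨z, a, hz, rfl⟩
    refine ⟨s(a, (σ.symm z).1), ⟨σ.symm z, a, by simpa using hz, rfl⟩, ?_⟩
    rw [Sym2.map_mk, hA a (hℓ _ _ hz), Equiv.Perm.ofSubtype_apply_coe]
    simp

namespace IsGraphProperty

variable {ι α : Type} {f : (ι → Bool) → Bool}
  {enc : Set (Sym2 α) → ι → Bool} {pairOf : ι → Option (Sym2 α)} [DecidableEq α]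

/-- Greedily grow stars around the centers in `A`, each as large as `f` being false permits. -/
theorem exists_saturated_forest (h : IsGraphProperty f enc pairOf) {Γ₀ : Set (Sym2 α)}
    {A L : Finset α} {β : ℕ} (hfalse : f (enc Γ₀) = false)
    (hstar : ∀ c ∈ A, ∀ V ⊆ L, V.card = β → f (enc (Γ₀ ∪ starPairs c V)) = true)
    (hA : A.card = β) :
    ∃ (P : Finset α) (ℓ : L → Option α), P ⊆ A ∧ (∀ z a, ℓ z = some a → a ∈ P) ∧
      f (enc (Γ₀ ∪ forestPairs ℓ)) = false ∧
      (∀ a ∈ P, ∀ z, ℓ z = none →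
        f (enc (Γ₀ ∪ forestPairs (Function.update ℓ z (some a)))) = true) ∧
      β ≤ ∑ a ∈ P, ((Finset.univ.filter fun z => ℓ z = some a).card + 1) ∧
      ∑ a ∈ P, ((Finset.univ.filter fun z => ℓ z = some a).card + 1) ≤ 2 * β := by
  -- Process the centers one by one and stop once the sum reaches `β`. If that never happens, all
  -- `β` centers are used and each contributes at least 1.
  have key : ∀ k ≤ β, ∃ (P : Finset α) (ℓ : L → Option α), P ⊆ A ∧
      (∀ z a, ℓ z = some a → a ∈ P) ∧ f (enc (Γ₀ ∪ forestPairs ℓ)) = false ∧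
      (∀ a ∈ P, ∀ z, ℓ z = none →
        f (enc (Γ₀ ∪ forestPairs (Function.update ℓ z (some a)))) = true) ∧
      (P.card = k ∨ β ≤ ∑ a ∈ P, ((Finset.univ.filter fun z => ℓ z = some a).card + 1)) ∧
      ∑ a ∈ P, ((Finset.univ.filter fun z => ℓ z = some a).card + 1) ≤ 2 * β := by
    intro k
    induction k with
    | zero =>
      refine fun _ => ⟨∅, fun _ => none, by simp, by simp, ?_, by simp, by simp, by simp⟩
      have : Γ₀ ∪ forestPairs (fun _ : L => (none : Option α)) = Γ₀ := by
        simp [forestPairs]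
      rw [this, hfalse]
    | succ k ih =>
      intro hk
      obtain ⟨P, ℓ, hPA, hℓP, hf, hsat, hS, hS2⟩ := ih (by omega)
      by_cases hge : β ≤ ∑ a ∈ P, ((Finset.univ.filter fun z => ℓ z = some a).card + 1)
      · exact ⟨P, ℓ, hPA, hℓP, hf, hsat, Or.inr hge, hS2⟩
      have hPk : P.card = k := hS.resolve_right hge
      obtain ⟨c, hcA, hcP⟩ : ∃ c ∈ A, c ∉ P := by
        by_contra! hsub
        have := Finset.card_le_card (show A ⊆ P from hsub)
        omega
      let ext : Finset L → L → Option α := fun V z => if z ∈ V then some c else ℓ z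
      let good : Finset (Finset L) := Finset.univ.filter fun V =>
        (∀ z ∈ V, ℓ z = none) ∧ f (enc (Γ₀ ∪ forestPairs (ext V))) = false
      have hgood : good.Nonempty := by
        refine ⟨∅, ?_⟩
        simp only [good, Finset.mem_filter, Finset.mem_univ, true_and]
        exact ⟨by simp, by simpa [ext] using hf⟩
      obtain ⟨V, hV, hmax⟩ := Finset.exists_max_image good Finset.card hgood
      simp only [good, Finset.mem_filter, Finset.mem_univ, true_and] at hV hmax
      have hmono : ∀ z a, ℓ z = some a → ext V z = some a := by
        intro z a hz
        have : z ∉ V := fun hzV => by simp [hV.1 z hzV] at hz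
        simp [ext, this, hz]
      -- A star with `β` leaves would already make `f` true. So a new center adds at most `β` to a
      -- sum that was below `β`, which keeps it at most `2 * β`.
      have hVcard : V.card < β := by
        by_contra! hVβ
        obtain ⟨V', hV'V, hV'⟩ := Finset.exists_subset_card_eq hVβ
        have h1 := hstar c hcA (V'.map (Function.Embedding.subtype _))
          (by
            intro x hx
            obtain ⟨y, -, rfl⟩ := Finset.mem_map.1 hx
            exact y.2) (by rw [Finset.card_map, hV'])
        have h2 := h.mono _ (Γ₀ ∪ forestPairs (ext V)) (Set.union_subset_union_right _ ?_) h1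
        · rw [hV.2] at h2
          exact Bool.noConfusion h2
        · rintro p ⟨z, hz, rfl⟩
          obtain ⟨y, hy, rfl⟩ := Finset.mem_map.1 (Finset.mem_coe.1 hz)
          exact ⟨y, c, by simp [ext, hV'V hy], rfl⟩
      have cntP : ∀ a ∈ P, (Finset.univ.filter fun z => ext V z = some a) =
          Finset.univ.filter fun z => ℓ z = some a := by
        intro a ha
        ext z
        simp only [Finset.mem_filter, Finset.mem_univ, true_and]
        refine ⟨fun hz => ?_, hmono z a⟩
        by_cases hzV : z ∈ V
        · simp only [ext, hzV, if_true, Option.some_inj] at hz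
          exact absurd (hz ▸ ha) hcP
        · simpa [ext, hzV] using hz
      have cntc : (Finset.univ.filter fun z => ext V z = some c) = V := by
        ext z
        simp only [Finset.mem_filter, Finset.mem_univ, true_and]
        refine ⟨fun hz => ?_, fun hz => by simp [ext, hz]⟩
        by_contra hzV
        simp only [ext, hzV, if_false] at hz
        exact hcP (hℓP z c hz)
      refine ⟨insert c P, ext V, Finset.insert_subset hcA hPA, ?_, hV.2, ?_, Or.inl ?_, ?_⟩
      · intro z a hz
        by_cases hzV : z ∈ V
        · simp only [ext, hzV, if_true, Option.some_inj] at hz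
          simp [hz]
        · simp only [ext, hzV, if_false] at hz
          exact Finset.mem_insert_of_mem (hℓP z a hz)
      · intro a ha z hz
        have hzV : z ∉ V := fun hzV => by simp [ext, hzV] at hz
        have hzℓ : ℓ z = none := by simpa [ext, hzV] using hz
        rcases Finset.mem_insert.1 ha with rfl | ha
        · by_contra hne
          have h1 := hmax (insert z V) ⟨?_, ?_⟩
          · rw [Finset.card_insert_of_notMem hzV] at h1
            omega
          · intro y hy
            rcases Finset.mem_insert.1 hy with rfl | hy
            exacts [hzℓ, hV.1 y hy]
          · rw [Bool.not_eq_true] at hne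
            rw [← hne]
            congr 4
            funext y
            by_cases hyz : y = z
            · subst hyz
              simp [ext]
            · simp [ext, hyz]
        -- Earlier centers stay saturated by monotonicity, since the forest only grows.
        · exact h.mono _ _ (Set.union_subset_union_right _ (forestPairs_update_mono hmono z a))
            (hsat a ha z hzℓ)
      · rw [Finset.card_insert_of_notMem hcP, hPk]
      · rw [Finset.sum_insert hcP, cntc, Finset.sum_congr rfl fun a ha => by rw [cntP a ha]]
        omega
  obtain ⟨P, ℓ, hPA, hℓP, hf, hsat, hS, hS2⟩ := key β le_rfl
  refine ⟨P, ℓ, hPA, hℓP, hf, hsat, ?_, hS2⟩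
  rcases hS with hS | hS
  · rw [Finset.sum_add_distrib, Finset.sum_const, hS]
    simp
  · exact hS

variable [Fintype ι] [DecidableEq ι] [Fintype α]

/-- The saturated forest is a partial assignment of leaves to centers whose rearrangements are
permutations of `L`; these fix `Γ₀` and the centers, so they preserve `f`. Of the `5 * β` leaves at
most `2 * β` are used, so `assignment_bound` gives `3 * β * β ≤ 1600 * q ^ 2`. -/
theorem star_bound (h : IsGraphProperty f enc pairOf) (Q : QueryAlgorithm ι) (hQ : Q.Computes f)
    {Γ₀ : Set (Sym2 α)} {A L : Finset α} {β : ℕ} (hAL : Disjoint A L)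
    (hΓ₀ : ∀ σ : Equiv.Perm α, (∀ x ∉ L, σ x = x) → Sym2.map σ '' Γ₀ = Γ₀)
    (hfalse : f (enc Γ₀) = false)
    (hstar : ∀ c ∈ A, ∀ V ⊆ L, V.card = β → f (enc (Γ₀ ∪ starPairs c V)) = true)
    (hA : A.card = β) (hL : 5 * β ≤ L.card) : β ≤ 40 * Q.queries := by
  obtain ⟨P, ℓ, hPA, hℓP, hf, hsat, hS, hS2⟩ := h.exists_saturated_forest hfalse hstar hA
  have hcomp : ∀ (ℓ : L → Option α), (∀ z a, ℓ z = some a → a ∈ A) → ∀ σ : Equiv.Perm L,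
      f (enc (Γ₀ ∪ forestPairs (ℓ ∘ σ))) = f (enc (Γ₀ ∪ forestPairs ℓ)) := by
    intro ℓ hℓ σ
    rw [← h.symm (Equiv.Perm.ofSubtype σ), Set.image_union, image_forestPairs hAL hℓ,
      hΓ₀ _ fun x hx => Equiv.Perm.ofSubtype_apply_of_not_mem σ hx]
  have hℓA : ∀ z a, ℓ z = some a → a ∈ A := fun z a hz => hPA (hℓP z a hz)
  have bound := Q.assignment_bound hQ (fun ℓ : L → Option α => enc (Γ₀ ∪ forestPairs ℓ))
    P ℓ ?_ ?_ ?_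
  · have hU : 3 * β ≤ (Finset.univ.filter fun z => ℓ z = none).card := by
      have h1 : (Finset.univ.filter fun z => ℓ z ≠ none) ⊆
          P.biUnion fun a => Finset.univ.filter fun z => ℓ z = some a := by
        intro z hz
        obtain ⟨a, ha⟩ := Option.ne_none_iff_exists'.1 (Finset.mem_filter.1 hz).2
        simp only [Finset.mem_biUnion, Finset.mem_filter, Finset.mem_univ, true_and]
        exact ⟨a, hℓP z a ha, ha⟩
      have h2 := (Finset.card_le_card h1).trans Finset.card_biUnion_le
      have h3 : ∑ a ∈ P, (Finset.univ.filter fun z => ℓ z = some a).card ≤ 2 * β :=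
        (Finset.sum_le_sum fun a _ => Nat.le_succ _).trans hS2
      have h4 := Finset.card_filter_add_card_filter_not (s := (Finset.univ : Finset L))
        (fun z => ℓ z = none)
      rw [Finset.card_univ, Fintype.card_coe] at h4
      simp only [ne_eq] at h2
      omega
    have h5 := (Nat.mul_le_mul hU hS).trans bound
    nlinarith
  · intro σ
    rw [← hf]
    exact hcomp ℓ hℓA σ
  · intro a ha σ z hz
    have hcongr : Function.update (ℓ ∘ σ) z (some a) =
        Function.update ℓ (σ z) (some a) ∘ σ := by
      exact (Function.update_comp_eq_of_injective ℓ σ.injective z (some a)).symm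
    rw [hcongr, hcomp _ _ σ]
    · exact hsat a ha (σ z) hz
    · intro y b hy
      by_cases hyz : y = σ z
      · subst hyz
        rw [Function.update_self, Option.some_inj] at hy
        exact hy ▸ hPA ha
      · rw [Function.update_of_ne hyz] at hy
        exact hℓA y b hy
  · intro k ℓ ℓ' z z' a ha a' ha' hz hz' hk hk'
    have new : ∀ (ℓ : L → Option α) (z : L) (a : α), ℓ z = none →
        enc (Γ₀ ∪ forestPairs (Function.update ℓ z (some a))) k ≠
        enc (Γ₀ ∪ forestPairs ℓ) k → pairOf k = some s(a, z.1) := by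
      intro ℓ z a hz hk
      obtain ⟨p, hp, hne⟩ := h.pairOf_eq_of_ne hk
      have sub : forestPairs ℓ ⊆ forestPairs (Function.update ℓ z (some a)) := by
        refine forestPairs_mono fun y b hy => ?_
        rwa [Function.update_of_ne]
        rintro rfl
        simp [hz] at hy
      rw [hp, Option.some_inj]
      by_contra hpz
      refine hne ⟨?_, fun h => Set.union_subset_union_right _ sub h⟩
      rintro (h1 | ⟨y, b, hy, rfl⟩)
      · exact Or.inl h1
      · refine Or.inr ⟨y, b, ?_, rfl⟩
        by_cases hyz : y = z
        · subst hyz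
          rw [Function.update_self, Option.some_inj] at hy
          exact absurd (by rw [hy]) hpz
        · rwa [Function.update_of_ne hyz] at hy
    have h1 := new ℓ z a hz hk
    rw [new ℓ' z' a' hz' hk', Option.some_inj, Sym2.eq_iff] at h1
    rcases h1 with ⟨h1, h2⟩ | ⟨h1, -⟩
    · exact ⟨Subtype.ext h2.symm, h1.symm⟩
    · exact absurd z.2 (Finset.disjoint_left.1 hAL (h1 ▸ hPA ha'))

/-- A monotone graph property that holds for a clique on at most an eighth of the vertices has a
linear query complexity. -/
theorem clique_bound (h : IsGraphProperty f enc pairOf) (Q : QueryAlgorithm ι) (hQ : Q.Computes f)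
    {β : ℕ} (hfalse : f (enc ∅) = false) {K : Finset α} (hK : K.card ≤ β)
    (htrue : f (enc (joinPairs (K : Set α) ∅)) = true) (hβ : 8 * β ≤ Fintype.card α) :
    β ≤ 40 * Q.queries := by
  classical
  rcases Nat.eq_zero_or_pos β with rfl | hβ0
  · exact Nat.zero_le _
  let T : Finset α → Finset α → Prop := fun D V => f (enc (joinPairs (D : Set α) V)) = true
  have Tmono : ∀ D V D' V' : Finset α, D ⊆ D' → D ∪ V ⊆ D' ∪ V' → T D V → T D' V' := by
    intro D V D' V' h1 h2
    exact h.mono _ _ (joinPairs_mono (by exact_mod_cast h1) (by exact_mod_cast h2))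
  -- The least such `r` is the number of clique vertices needed alongside `β` independent ones. It
  -- is at most `K.card`, and positive because the empty graph is rejected.
  let ex : ∃ r, ∃ D V : Finset α, Disjoint D V ∧ D.card = r ∧ V.card = β ∧ T D V := by
    obtain ⟨V, hV, hVβ⟩ := Finset.exists_subset_card_eq (s := Kᶜ) (n := β)
      (by rw [Finset.card_compl]; omega)
    refine ⟨K.card, K, V, ?_, rfl, hVβ, ?_⟩
    · exact (Finset.disjoint_left.2 fun x hx hx' => Finset.mem_compl.1 (hV hx') hx)
    · refine h.mono _ _ (joinPairs_mono subset_rfl ?_) htrue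
      simp
  obtain ⟨D', V', hd', hD', hV', hT'⟩ := Nat.find_spec ex
  have hmin : ∀ D V : Finset α, Disjoint D V → D.card < Nat.find ex → V.card = β → ¬T D V :=
    fun D V hd hD hV hT => Nat.find_min ex hD ⟨D, V, hd, rfl, hV, hT⟩
  have hrK : Nat.find ex ≤ K.card := by
    obtain ⟨V, hV, hVβ⟩ := Finset.exists_subset_card_eq (s := Kᶜ) (n := β)
      (by rw [Finset.card_compl]; omega)
    refine Nat.find_min' ex ⟨K, V, ?_, rfl, hVβ, ?_⟩
    · exact (Finset.disjoint_left.2 fun x hx hx' => Finset.mem_compl.1 (hV hx') hx)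
    · refine h.mono _ _ (joinPairs_mono subset_rfl ?_) htrue
      simp
  obtain ⟨c, hc⟩ : D'.Nonempty := by
    by_contra hne
    rw [Finset.not_nonempty_iff_eq_empty] at hne
    subst hne
    have : joinPairs ((∅ : Finset α) : Set α) V' = ∅ := by
      ext p
      simp [joinPairs]
    simp only [T, this, hfalse] at hT'
    exact Bool.noConfusion hT'
  set D := D'.erase c with hD
  have hDcard : D.card + 1 = Nat.find ex := by
    rw [hD, Finset.card_erase_add_one hc, hD']
  have hcD : c ∉ D := Finset.notMem_erase c D'
  have hcV' : c ∉ V' := Finset.disjoint_left.1 hd' hc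
  have hDc : 7 * β ≤ Dᶜ.card := by
    rw [Finset.card_compl]
    omega
  have hsub : insert c V' ⊆ Dᶜ := by
    intro x hx
    rw [Finset.mem_compl]
    rcases Finset.mem_insert.1 hx with rfl | hx
    · exact hcD
    · exact fun hxD => Finset.disjoint_left.1 hd' (Finset.mem_of_mem_erase hxD) hx
  obtain ⟨W, hcW, hWD, hW⟩ := Finset.exists_subsuperset_card_eq hsub (n := 6 * β)
    (by rw [Finset.card_insert_of_notMem hcV']; omega) (by omega)
  have disj_of : ∀ V, V ⊆ Dᶜ → Disjoint D V := fun V hV =>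
    Finset.disjoint_left.2 fun x hx hx' => Finset.mem_compl.1 (hV hx') hx
  by_cases hTW : T D W
  -- The threshold for the number of independent vertices next to `r - 1` clique vertices. It
  -- exceeds `β` by minimality of `r`, and is at most `6 * β`.
  · let ex' : ∃ b, ∃ V : Finset α, V ⊆ Dᶜ ∧ V.card = b ∧ T D V := ⟨_, W, hWD, rfl, hTW⟩
    obtain ⟨V, hVD, hV, hTV⟩ := Nat.find_spec ex'
    have hVW : V.card ≤ 6 * β := by
      rw [hV, ← hW]
      exact Nat.find_min' ex' ⟨W, hWD, rfl, hTW⟩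
    have hβV : β < V.card := by
      by_contra! hle
      obtain ⟨V₁, hVV₁, hV₁D, hV₁⟩ := Finset.exists_subsuperset_card_eq hVD (n := β) hle
        (by omega)
      exact hmin D V₁ (disj_of _ hV₁D) (by omega) hV₁
        (Tmono _ _ _ _ subset_rfl (Finset.union_subset_union_right hVV₁) hTV)
    obtain ⟨z, hz⟩ : V.Nonempty := Finset.card_pos.1 (by omega)
    have hcard := Finset.card_erase_add_one hz
    have hE : V.erase z ⊆ Dᶜ := (Finset.erase_subset _ _).trans hVD
    have hfe : ¬T D (V.erase z) := fun hT =>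
      Nat.find_min ex' (m := (V.erase z).card) (by omega) ⟨_, hE, rfl, hT⟩
    have := h.join_bound Q hQ (disj_of _ hE) (Finset.mem_compl.1 (hVD hz)) (Finset.notMem_erase z V)
      (by simpa [T] using hfe) (by rw [Finset.insert_erase hz]; exact hTV)
    -- At least `7 * β - 6 * β` vertices remain free, and the second factor is the threshold, which
    -- exceeds `β`.
    have h2 : β * β ≤ 1600 * Q.queries ^ 2 :=
      (Nat.mul_le_mul (by omega) (by omega)).trans this
    nlinarith
  · obtain ⟨A, hcA, hAW, hA⟩ := Finset.exists_subsuperset_card_eq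
      (show {c} ⊆ W from Finset.singleton_subset_iff.2 (hcW (Finset.mem_insert_self _ _)))
      (n := β) (by rw [Finset.card_singleton]; exact hβ0) (by omega)
    refine h.star_bound Q hQ (Γ₀ := joinPairs (D : Set α) W) (A := A) (L := W \ A)
      Finset.disjoint_sdiff ?_ (by simpa [T] using hTW) ?_ hA ?_
    · intro σ hσ
      have hfix : ∀ x ∈ D, σ x = x := fun x hx => hσ x fun hx' =>
        Finset.mem_compl.1 (hWD (Finset.mem_sdiff.1 hx').1) hx
      have hW' : ∀ x ∈ W, σ x ∈ W := by
        intro x hx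
        by_contra hx'
        have h1 := hσ (σ x) fun h1 => hx' (Finset.mem_sdiff.1 h1).1
        rw [σ.injective h1] at hx'
        exact hx' hx
      have e1 : σ '' (D : Set α) = D := by
        ext y
        constructor
        · rintro ⟨x, hx, rfl⟩
          rwa [hfix x hx]
        · exact fun hy => ⟨y, hy, hfix y hy⟩
      have e2 : σ '' (W : Set α) = W := by
        have : W.map σ.toEmbedding = W := by
          refine Finset.eq_of_subset_of_card_le ?_ (by simp)
          intro y hy
          obtain ⟨x, hx, rfl⟩ := Finset.mem_map.1 hy
          exact hW' x hx
        rw [← Finset.coe_inj, Finset.coe_map] at this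
        exact this
      rw [image_joinPairs, e1, e2]
    -- `D` is already joined to all of `W`, so the star turns `a` into a further clique vertex
    -- relative to `V`: the graph contains `r` clique vertices joined to `β` independent ones.
    · intro a ha V hV hVβ
      have haW := hAW ha
      have haD : a ∉ D := Finset.mem_compl.1 (hWD haW)
      have hVW : V ⊆ W := hV.trans Finset.sdiff_subset
      have haV : a ∉ V := fun h1 => (Finset.mem_sdiff.1 (hV h1)).2 ha
      have h1 : T (insert a D) V := by
        have := h.join_congr (D := insert a D) (V := V) (D' := D') (V' := V') ?_ hd' ?_ ?_
        · exact this.trans hT'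
        · rw [Finset.disjoint_insert_left]
          exact ⟨haV, disj_of _ (hVW.trans hWD)⟩
        · rw [Finset.card_insert_of_notMem haD, hDcard, hD']
        · rw [hVβ, hV']
      refine h.mono _ _ ?_ h1
      rintro p ⟨x, hx, y, hy, hxy, rfl⟩
      have hx : x = a ∨ x ∈ D := by simpa using hx
      have hy : (y = a ∨ y ∈ D) ∨ y ∈ V := by simpa using hy
      have inD : ∀ x ∈ D, ∀ y, x ≠ y → (y = a ∨ y ∈ D) ∨ y ∈ V →
          s(x, y) ∈ joinPairs (D : Set α) W := by
        intro x hx y hxy hy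
        refine ⟨x, hx, y, ?_, hxy, rfl⟩
        rcases hy with (rfl | hy) | hy
        exacts [Or.inr haW, Or.inl hy, Or.inr (hVW hy)]
      rcases hx with rfl | hx
      · rcases hy with (rfl | hy) | hy
        · exact absurd rfl hxy
        · rw [Sym2.eq_swap]
          exact Or.inl (inD y hy x hxy.symm (Or.inl (Or.inl rfl)))
        · exact Or.inr ⟨y, hy, rfl⟩
      · exact Or.inl (inD x hx y hxy hy)
    · rw [Finset.card_sdiff_of_subset hAW]
      omega

end IsGraphProperty

/-! ## Hypergraph properties -/

/-- The image of a triple under a permutation of the vertices. -/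
def Triple.map {n : ℕ} (σ : Equiv.Perm (Fin n)) (s : Triple n) : Triple n :=
  ⟨s.1.map σ.toEmbedding, by rw [Finset.card_map, s.2]⟩

theorem Triple.map_injective {n : ℕ} (σ : Equiv.Perm (Fin n)) :
    Function.Injective (Triple.map σ) := by
  intro s t h
  exact Subtype.ext (Finset.map_injective _ (congrArg Subtype.val h))

theorem Triple.map_one {n : ℕ} (s : Triple n) : s.map 1 = s :=
  Subtype.ext Finset.map_refl

theorem Triple.exists_eq {n : ℕ} (s : Triple n) {v : Fin n} (hv : v ∈ s.1) :
    ∃ a b, a ≠ b ∧ a ≠ v ∧ b ≠ v ∧ s.1 = {v, a, b} := by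
  have h : (s.1.erase v).card = 2 := by rw [Finset.card_erase_of_mem hv, s.2]
  obtain ⟨a, b, hab, he⟩ := Finset.card_eq_two.1 h
  have ha : a ∈ s.1.erase v := by simp [he]
  have hb : b ∈ s.1.erase v := by simp [he]
  exact ⟨a, b, hab, (Finset.mem_erase.1 ha).1, (Finset.mem_erase.1 hb).1, by
    rw [← Finset.insert_erase hv, he]⟩

theorem pair_eq_of_insert_eq {n : ℕ} {W : Finset (Fin n)} {v : Fin n} (hv : v ∉ W) {a b a' b' : W}
    (hab : a ≠ b) (h : ({v, a.1, b.1} : Finset (Fin n)) = {v, a'.1, b'.1}) :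
    s(a, b) = s(a', b') := by
  have hne : ∀ x : W, x.1 ≠ v := fun x hx => hv (hx ▸ x.2)
  have ha : a.1 ∈ ({v, a'.1, b'.1} : Finset (Fin n)) := by simp [← h]
  have hb : b.1 ∈ ({v, a'.1, b'.1} : Finset (Fin n)) := by simp [← h]
  simp only [Finset.mem_insert, Finset.mem_singleton, hne, false_or, Subtype.ext_iff.symm] at ha hb
  rw [Sym2.eq_iff]
  rcases ha with rfl | rfl <;> rcases hb with rfl | rfl <;> simp_all

open Classical in
/-- The input whose true bits are the triples that satisfy `p`. -/
noncomputable def inputOfPred {n : ℕ} (p : Triple n → Prop) : Triple n → Bool :=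
  fun s => decide (p s)

theorem inputOfPred_eq_true {n : ℕ} {p : Triple n → Prop} {s : Triple n} :
    inputOfPred p s = true ↔ p s := by
  simp [inputOfPred]

/-- The hypergraph with the triples in `base` and those that consist of `v` and a pair in `Γ`. -/
noncomputable def linkInput {n : ℕ} (base : Finset (Fin n) → Prop) (v : Fin n)
    (W : Finset (Fin n)) (Γ : Set (Sym2 W)) : Triple n → Bool :=
  inputOfPred fun s => base s.1 ∨ ∃ a b : W, a ≠ b ∧ s.1 = {v, a.1, b.1} ∧ s(a, b) ∈ Γ

open Classical in
-- With `base` invariant under permutations of `W`, the input depends on a graph on `W`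
-- symmetrically and monotonically, and a triple through `v` reads only the pair of its other two
-- vertices. So `clique_bound` applies.
theorem link_bound {n : ℕ} {f : (Triple n → Bool) → Bool}
    (hmono : ∀ x y : Triple n → Bool, (∀ s, x s = true → y s = true) → f x = true → f y = true)
    (hsymm : ∀ (σ : Equiv.Perm (Fin n)) x, f (fun s => x (s.map σ)) = f x)
    (Q : QueryAlgorithm (Triple n)) (hQ : Q.Computes f) (base : Finset (Fin n) → Prop)
    {v : Fin n} {W K : Finset (Fin n)} (hv : v ∉ W) (hKW : K ⊆ W)
    (hbase : ∀ τ : Equiv.Perm (Fin n), (∀ x ∉ W, τ x = x) →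
      ∀ s : Finset (Fin n), base (s.map τ.toEmbedding) ↔ base s)
    (hfalse : f (inputOfPred fun s => base s.1) = false)
    (htrue : f (inputOfPred fun s =>
      base s.1 ∨ ∃ a ∈ K, ∃ b ∈ K, a ≠ b ∧ s.1 = {v, a, b}) = true)
    {β : ℕ} (hK : K.card ≤ β) (hβ : 8 * β ≤ W.card) : β ≤ 40 * Q.queries := by
  let pairOf : Triple n → Option (Sym2 W) := fun s =>
    if h : ∃ p : Sym2 W, ∃ a b : W, a ≠ b ∧ s.1 = {v, a.1, b.1} ∧ p = s(a, b) then
      some h.choose else none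
  have pairOf_eq : ∀ (s : Triple n) (a b : W), a ≠ b → s.1 = {v, a.1, b.1} →
      pairOf s = some s(a, b) := by
    intro s a b hab hs
    have h : ∃ p : Sym2 W, ∃ a b : W, a ≠ b ∧ s.1 = {v, a.1, b.1} ∧ p = s(a, b) :=
      ⟨_, a, b, hab, hs, rfl⟩
    obtain ⟨a', b', hab', hs', hp⟩ := h.choose_spec
    simp only [pairOf, dif_pos h]
    rw [hp, pair_eq_of_insert_eq hv hab (hs.symm.trans hs')]
  have hprop : IsGraphProperty f (linkInput base v W) pairOf := by
    refine ⟨?_, ?_, ?_⟩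
    · intro Γ Γ' s h
      have : (∃ a b : W, a ≠ b ∧ s.1 = {v, a.1, b.1} ∧ s(a, b) ∈ Γ) ↔
          ∃ a b : W, a ≠ b ∧ s.1 = {v, a.1, b.1} ∧ s(a, b) ∈ Γ' :=
        exists_congr fun a => exists_congr fun b => and_congr_right fun hab =>
          and_congr_right fun hs => h _ (pairOf_eq s a b hab hs)
      rw [Bool.eq_iff_iff]
      simp only [linkInput, inputOfPred_eq_true, this]
    · intro Γ Γ' h
      refine hmono _ _ fun s hs => ?_
      simp only [linkInput, inputOfPred_eq_true] at hs ⊢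
      exact hs.imp_right fun ⟨a, b, hab, hs, hp⟩ => ⟨a, b, hab, hs, h hp⟩
    · intro σ Γ
      have hτ : ∀ x ∉ W, Equiv.Perm.ofSubtype σ x = x := fun x hx =>
        Equiv.Perm.ofSubtype_apply_of_not_mem σ hx
      rw [← hsymm (Equiv.Perm.ofSubtype σ)]
      congr 1
      funext s
      rw [Bool.eq_iff_iff]
      simp only [linkInput, inputOfPred_eq_true, Triple.map]
      refine or_congr (hbase _ hτ _) ⟨?_, ?_⟩
      · rintro ⟨a, b, hab, hs, hp⟩
        obtain ⟨p, hp, hpe⟩ := hp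
        refine ⟨σ.symm a, σ.symm b, fun h => hab (σ.symm.injective h), ?_, ?_⟩
        · apply Finset.map_injective (Equiv.Perm.ofSubtype σ).toEmbedding
          rw [hs]
          simp [hτ v hv]
        · have : p = s(σ.symm a, σ.symm b) := by
            apply Sym2.map.injective σ.injective
            rw [hpe]
            simp
          rwa [← this]
      · rintro ⟨a, b, hab, hs, hp⟩
        refine ⟨σ a, σ b, fun h => hab (σ.injective h), ?_, ⟨_, hp, by simp⟩⟩
        rw [hs]
        simp [hτ v hv]
  refine hprop.clique_bound Q hQ (K := K.subtype (· ∈ W)) ?_ ?_ ?_ (by simpa using hβ)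
  · rw [← hfalse]
    congr 1
    simp [linkInput]
  · exact (Finset.card_subtype _ _).trans_le ((Finset.card_filter_le _ _).trans hK)
  · refine hmono _ _ (fun s hs => ?_) htrue
    simp only [linkInput, inputOfPred_eq_true] at hs ⊢
    refine hs.imp_right ?_
    rintro ⟨a, ha, b, hb, hab, hs⟩
    refine ⟨⟨a, hKW ha⟩, ⟨b, hKW hb⟩, fun h => hab (congrArg Subtype.val h), hs, ?_⟩
    refine ⟨⟨a, hKW ha⟩, ?_, ⟨b, hKW hb⟩, ?_, fun h => hab (congrArg Subtype.val h), rfl⟩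
    · simpa using ha
    · simpa using hb

/-! ## Containing a copy of a fixed hypergraph -/

section Copies

variable {n : ℕ} {f : (Triple n → Bool) → Bool} {E : Finset (Triple n)}

theorem mono_of_copies
    (hf : ∀ x, f x = true ↔ ∃ σ : Equiv.Perm (Fin n), ∀ e ∈ E, x (e.map σ) = true)
    (x y : Triple n → Bool) (h : ∀ s, x s = true → y s = true) (hx : f x = true) :
    f y = true := by
  obtain ⟨σ, hσ⟩ := (hf x).1 hx
  exact (hf y).2 ⟨σ, fun e he => h _ (hσ e he)⟩

theorem symm_of_copies
    (hf : ∀ x, f x = true ↔ ∃ σ : Equiv.Perm (Fin n), ∀ e ∈ E, x (e.map σ) = true)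
    (τ : Equiv.Perm (Fin n)) (x : Triple n → Bool) : f (fun s => x (s.map τ)) = f x := by
  have hcomp : ∀ (σ τ : Equiv.Perm (Fin n)) (s : Triple n),
      (s.map σ).map τ = s.map (σ.trans τ) := by
    intro σ τ s
    apply Subtype.ext
    simp [Triple.map, Finset.map_map]
  rw [Bool.eq_iff_iff, hf, hf]
  constructor
  · rintro ⟨σ, hσ⟩
    exact ⟨σ.trans τ, fun e he => by rw [← hcomp]; exact hσ e he⟩
  · rintro ⟨σ, hσ⟩
    refine ⟨σ.trans τ.symm, fun e he => ?_⟩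
    rw [hcomp, Equiv.trans_assoc, Equiv.symm_trans_self, Equiv.trans_refl]
    exact hσ e he

open Classical in
-- The hidden object is one missing edge of `H` itself. The sites are the edges, exactly one is free
-- and the others share one class, so `assignment_bound` has the product `1 * E.card`.
theorem card_edges_le
    (hf : ∀ x, f x = true ↔ ∃ σ : Equiv.Perm (Fin n), ∀ e ∈ E, x (e.map σ) = true)
    (hE : E.Nonempty) (Q : QueryAlgorithm (Triple n)) (hQ : Q.Computes f) :
    E.card ≤ 1600 * Q.queries ^ 2 := by
  obtain ⟨e₀, he₀⟩ := hE
  let ℓ₀ : E → Option Unit := fun e => if e = ⟨e₀, he₀⟩ then none else some ()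
  have bound := Q.assignment_bound hQ
    (fun (ℓ : E → Option Unit) => inputOfPred fun s => ∃ h : s ∈ E, ℓ ⟨s, h⟩ = some ()) Finset.univ ℓ₀ ?_ ?_ ?_
  · have c1 : (Finset.univ.filter fun z => ℓ₀ z = none) = {⟨e₀, he₀⟩} := by
      ext z
      simp [ℓ₀]
    have c2 : (Finset.univ.filter fun z => ℓ₀ z = some ()) = Finset.univ.erase ⟨e₀, he₀⟩ := by
      ext z
      simp [ℓ₀]
    have c3 := Finset.card_erase_add_one (Finset.mem_univ (⟨e₀, he₀⟩ : E))
    simp only [c1, Finset.card_singleton, Finset.univ_unique, Finset.sum_singleton,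
      PUnit.default_eq_unit, c2, c3, one_mul] at bound
    simpa using bound
  · intro σ
    rw [← Bool.not_eq_true, hf]
    rintro ⟨τ, hτ⟩
    simp only [inputOfPred_eq_true] at hτ
    set e₁ := σ.symm ⟨e₀, he₀⟩ with he₁
    -- A copy would inject `E` into `E` minus an edge.
    have hsub : E.image (Triple.map τ) ⊆ E.erase e₁.1 := by
      intro s hs
      obtain ⟨e, he, rfl⟩ := Finset.mem_image.1 hs
      obtain ⟨h1, h2⟩ := hτ e he
      refine Finset.mem_erase.2 ⟨fun h3 => ?_, h1⟩
      have h4 : (⟨Triple.map τ e, h1⟩ : E) = e₁ := Subtype.ext h3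
      rw [h4] at h2
      simp [ℓ₀, he₁] at h2
    have h1 := Finset.card_le_card hsub
    rw [Finset.card_image_of_injective _ (Triple.map_injective τ)] at h1
    have h2 := Finset.card_erase_add_one e₁.2
    omega
  · rintro ⟨⟩ - σ z hz
    rw [hf]
    refine ⟨1, fun e he => ?_⟩
    rw [Triple.map_one, inputOfPred_eq_true]
    refine ⟨he, ?_⟩
    by_cases hez : (⟨e, he⟩ : E) = z
    · rw [hez, Function.update_self]
    · rw [Function.update_of_ne hez]
      have h2 : σ z = ⟨e₀, he₀⟩ := by
        by_contra h
        simp [ℓ₀, h] at hz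
      have h3 : σ ⟨e, he⟩ ≠ ⟨e₀, he₀⟩ := fun h => hez (σ.injective (h.trans h2.symm))
      simp [ℓ₀, h3]
  · rintro k ℓ ℓ' z z' ⟨⟩ - ⟨⟩ - - - hk hk'
    have new : ∀ (ℓ : E → Option Unit) (z : E),
        inputOfPred (fun s => ∃ h : s ∈ E, Function.update ℓ z (some ()) ⟨s, h⟩ = some ()) k ≠
          inputOfPred (fun s => ∃ h : s ∈ E, ℓ ⟨s, h⟩ = some ()) k → k = z.1 := by
      intro ℓ z hk
      by_contra hkz
      refine hk ?_
      rw [Bool.eq_iff_iff, inputOfPred_eq_true, inputOfPred_eq_true]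
      refine exists_congr fun h => ?_
      rw [Function.update_of_ne]
      exact fun h => hkz (congrArg Subtype.val h)
    exact ⟨Subtype.ext ((new ℓ z hk).symm.trans (new ℓ' z' hk')), rfl⟩

/-- Few vertices are isolated: look at the link of a vertex of minimum degree. -/
theorem card_support_le
    (hf : ∀ x, f x = true ↔ ∃ σ : Equiv.Perm (Fin n), ∀ e ∈ E, x (e.map σ) = true)
    (hE : E.Nonempty) (Q : QueryAlgorithm (Triple n)) (hQ : Q.Computes f) :
    (E.biUnion Subtype.val).card ≤ 793 * Q.queries := by
  classical
  set N := E.biUnion Subtype.val with hN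
  have hm := card_edges_le hf hE Q hQ
  have hm1 : 1 ≤ E.card := hE.card_pos
  have hQ1 : 1 ≤ Q.queries := by
    by_contra! h
    have : Q.queries = 0 := by omega
    rw [this] at hm
    omega
  let deg : Fin n → ℕ := fun v => (E.filter fun e => v ∈ e.1).card
  have hNne : N.Nonempty := by
    obtain ⟨e, he⟩ := hE
    obtain ⟨v, hv⟩ : e.1.Nonempty := Finset.card_pos.1 (by rw [e.2]; norm_num)
    exact ⟨v, Finset.mem_biUnion.2 ⟨e, he, hv⟩⟩
  obtain ⟨u, hu, humin⟩ := Finset.exists_min_image N deg hNne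
  -- Double counting of incidences: each edge has three vertices.
  have hsum : N.card * deg u ≤ 3 * E.card := by
    calc N.card * deg u = ∑ v ∈ N, deg u := by rw [Finset.sum_const, smul_eq_mul]
      _ ≤ ∑ v ∈ N, deg v := Finset.sum_le_sum humin
      _ ≤ ∑ v, deg v := Finset.sum_le_sum_of_subset (Finset.subset_univ _)
      _ = ∑ e ∈ E, (Finset.univ.filter fun v => v ∈ e.1).card :=
          Finset.sum_card_bipartiteAbove_eq_sum_card_bipartiteBelow fun v (e : Triple n) => v ∈ e.1
      _ = ∑ e ∈ E, 3 := Finset.sum_congr rfl fun e _ => by simp [e.2]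
      _ = 3 * E.card := by rw [Finset.sum_const, smul_eq_mul, mul_comm]
  set C := N.erase u with hC
  have hCcard : C.card + 1 = N.card := Finset.card_erase_add_one hu
  set K := (E.filter fun e => u ∈ e.1).biUnion fun e => e.1.erase u with hK
  have hKcard : K.card ≤ deg u * 2 := by
    refine Finset.card_biUnion_le_card_mul _ _ _ fun e he => ?_
    rw [Finset.card_erase_of_mem (Finset.mem_filter.1 he).2, e.2]
  have hKC : K ⊆ C := by
    intro x hx
    obtain ⟨e, he, hxe⟩ := Finset.mem_biUnion.1 hx
    exact Finset.mem_erase.2 ⟨(Finset.mem_erase.1 hxe).1,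
      Finset.mem_biUnion.2 ⟨e, (Finset.mem_filter.1 he).1, (Finset.mem_erase.1 hxe).2⟩⟩
  have main : C.card / 8 ≤ 98 * Q.queries := by
    by_cases hdeg : deg u * 2 ≤ C.card / 8
    · have := link_bound (mono_of_copies hf) (symm_of_copies hf) Q hQ (fun s => s ⊆ C) (W := C)
        (Finset.notMem_erase u N) hKC ?_ ?_ ?_ (hKcard.trans hdeg) (by omega)
      · omega
      · intro τ hτ s
        have hC' : ∀ x, τ x ∈ C ↔ x ∈ C := by
          intro x
          by_cases hx : x ∈ C
          · refine iff_of_true ?_ hx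
            by_contra h
            rw [τ.injective (hτ _ h)] at h
            exact h hx
          · rw [hτ x hx]
        constructor
        · exact fun h x hx => (hC' x).1 (h (Finset.mem_map_of_mem _ hx))
        · intro h y hy
          obtain ⟨x, hx, rfl⟩ := Finset.mem_map.1 hy
          exact (hC' x).2 (h hx)
      -- A copy of `H` needs `N.card` non-isolated vertices, but the base triples cover only `C`,
      -- one fewer.
      · rw [← Bool.not_eq_true, hf]
        rintro ⟨σ, hσ⟩
        have : N.map σ.toEmbedding ⊆ C := by
          intro y hy
          obtain ⟨x, hx, rfl⟩ := Finset.mem_map.1 hy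
          obtain ⟨e, he, hxe⟩ := Finset.mem_biUnion.1 hx
          exact inputOfPred_eq_true.1 (hσ e he) (Finset.mem_map_of_mem _ hxe)
        have := Finset.card_le_card this
        rw [Finset.card_map] at this
        omega
      · rw [hf]
        refine ⟨1, fun e he => ?_⟩
        rw [Triple.map_one, inputOfPred_eq_true]
        by_cases hue : u ∈ e.1
        · obtain ⟨a, b, hab, ha, hb, hs⟩ := e.exists_eq hue
          have hmem : ∀ x ∈ e.1, x ≠ u → x ∈ K := fun x hx hxu =>
            Finset.mem_biUnion.2 ⟨e, Finset.mem_filter.2 ⟨he, hue⟩, Finset.mem_erase.2 ⟨hxu, hx⟩⟩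
          exact Or.inr ⟨a, hmem a (by simp [hs]) ha, b, hmem b (by simp [hs]) hb, hab, hs⟩
        · exact Or.inl fun x hx => Finset.mem_erase.2
            ⟨fun h => hue (h ▸ hx), Finset.mem_biUnion.2 ⟨e, he, hx⟩⟩
    -- Large minimum degree forces many edges: `9600 = 2 * 3 * 1600`, and `98 ^ 2` is just above it.
    · push Not at hdeg
      have h1 : C.card / 8 ≤ N.card := by omega
      have h2 : (C.card / 8) * (C.card / 8) ≤ 9600 * Q.queries ^ 2 := by
        calc (C.card / 8) * (C.card / 8) ≤ N.card * (deg u * 2) := Nat.mul_le_mul h1 hdeg.le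
          _ = 2 * (N.card * deg u) := by ring
          _ ≤ 9600 * Q.queries ^ 2 := by omega
      nlinarith
  omega

/-- Many vertices are isolated: look at the link of the last vertex of a smallest set such that all
the triples that meet it contain a copy. -/
theorem linear_bound_of_card_support_le
    (hf : ∀ x, f x = true ↔ ∃ σ : Equiv.Perm (Fin n), ∀ e ∈ E, x (e.map σ) = true)
    (hE : E.Nonempty) (Q : QueryAlgorithm (Triple n)) (hQ : Q.Computes f)
    (hN : (E.biUnion Subtype.val).card ≤ n / 16) : n / 16 ≤ 40 * Q.queries := by
  classical
  set N := E.biUnion Subtype.val with hNdef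
  let touch : Finset (Fin n) → Triple n → Bool := fun T => inputOfPred fun s => ¬Disjoint s.1 T
  have hNmem : N ∈ Finset.univ.filter fun T => f (touch T) = true := by
    simp only [Finset.mem_filter, Finset.mem_univ, true_and]
    rw [hf]
    refine ⟨1, fun e he => ?_⟩
    rw [Triple.map_one]
    simp only [touch, inputOfPred_eq_true]
    obtain ⟨v, hv⟩ : e.1.Nonempty := Finset.card_pos.1 (by rw [e.2]; norm_num)
    exact fun h => Finset.disjoint_left.1 h hv (Finset.mem_biUnion.2 ⟨e, he, hv⟩)
  obtain ⟨T, hT, hTmin⟩ := Finset.exists_min_image _ Finset.card ⟨N, hNmem⟩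
  have hTN := hTmin N hNmem
  replace hT : f (touch T) = true := (Finset.mem_filter.1 hT).2
  obtain ⟨v, hv⟩ : T.Nonempty := by
    by_contra hne
    rw [Finset.not_nonempty_iff_eq_empty] at hne
    rw [hne, hf] at hT
    obtain ⟨σ, hσ⟩ := hT
    obtain ⟨e, he⟩ := hE
    simpa [touch, inputOfPred_eq_true] using hσ e he
  have hlt : f (touch (T.erase v)) = false := by
    by_contra h
    rw [Bool.not_eq_false] at h
    have h1 := hTmin (T.erase v) (Finset.mem_filter.2 ⟨Finset.mem_univ _, h⟩)
    have h2 := Finset.card_erase_add_one hv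
    omega
  obtain ⟨σ, hσ⟩ := (hf _).1 hT
  have hcompl : Tᶜ.card = n - T.card := by rw [Finset.card_compl, Fintype.card_fin]
  -- Here `β = n / 16`. Since `T` is no larger than `N`, its complement has at least `8 * (n / 16)`
  -- vertices.
  refine link_bound (mono_of_copies hf) (symm_of_copies hf) Q hQ
    (fun s => ¬Disjoint s (T.erase v)) (v := v) (W := Tᶜ) (K := Tᶜ ∩ N.map σ.toEmbedding)
    (fun h => Finset.mem_compl.1 h hv) Finset.inter_subset_left ?_ ?_ ?_ ?_ ?_
  · intro τ hτ s
    have hfix : ∀ x ∈ T, τ x = x := fun x hx => hτ x fun h => Finset.mem_compl.1 h hx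
    rw [not_iff_not, Finset.disjoint_left, Finset.disjoint_left]
    constructor
    · intro h x hx hxT
      refine h (Finset.mem_map_of_mem _ hx) ?_
      rwa [Equiv.toEmbedding_apply, hfix x (Finset.mem_of_mem_erase hxT)]
    · intro h y hy hyT
      obtain ⟨x, hx, rfl⟩ := Finset.mem_map.1 hy
      have h1 : τ x = x := τ.injective (hfix _ (Finset.mem_of_mem_erase hyT))
      rw [Equiv.toEmbedding_apply, h1] at hyT
      exact h hx hyT
  · exact hlt
  · rw [hf]
    refine ⟨σ, fun e he => ?_⟩
    rw [inputOfPred_eq_true]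
    -- An edge of the copy that misses `T.erase v` meets `T` only in `v`; its other two vertices lie
    -- outside `T` and in the image of `N`, hence in the clique.
    by_cases hd : Disjoint (e.map σ).1 (T.erase v)
    · refine Or.inr ?_
      have h1 := inputOfPred_eq_true.1 (hσ e he)
      rw [Finset.not_disjoint_iff] at h1
      obtain ⟨y, hy, hyT⟩ := h1
      have hyv : y = v := by
        by_contra h
        exact Finset.disjoint_left.1 hd hy (Finset.mem_erase.2 ⟨h, hyT⟩)
      subst hyv
      obtain ⟨a, b, hab, ha, hb, hs⟩ := (e.map σ).exists_eq hy
      have hmem : ∀ x ∈ (e.map σ).1, x ≠ y → x ∈ Tᶜ ∩ N.map σ.toEmbedding := by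
        intro x hx hxy
        refine Finset.mem_inter.2 ⟨Finset.mem_compl.2 fun h => ?_, ?_⟩
        · exact Finset.disjoint_left.1 hd hx (Finset.mem_erase.2 ⟨hxy, h⟩)
        · exact Finset.map_subset_map.2 (Finset.subset_biUnion_of_mem Subtype.val he) hx
      exact ⟨a, hmem a (by simp [hs]) ha, b, hmem b (by simp [hs]) hb, hab, hs⟩
    · exact Or.inl hd
  · refine (Finset.card_le_card Finset.inter_subset_right).trans ?_
    rw [Finset.card_map]
    exact hN
  · rw [hcompl]
    omega

/-- If more than `n / 16` vertices are non-isolated, `card_support_le` gives `n ≤ 16 * 793 * q`;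
otherwise the other case gives about `640 * q`. Both are below `13000 * q`. -/
theorem linear_bound
    (hf : ∀ x, f x = true ↔ ∃ σ : Equiv.Perm (Fin n), ∀ e ∈ E, x (e.map σ) = true)
    (hE : E.Nonempty) (Q : QueryAlgorithm (Triple n)) (hQ : Q.Computes f) :
    n ≤ 13000 * Q.queries := by
  have h1 := card_support_le hf hE Q hQ
  have h2 := linear_bound_of_card_support_le hf hE Q hQ
  have hm := card_edges_le hf hE Q hQ
  have hm1 : 1 ≤ E.card := hE.card_pos
  have hQ1 : 1 ≤ Q.queries := by
    by_contra! h
    have : Q.queries = 0 := by omega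
    rw [this] at hm
    omega
  by_cases hN : (E.biUnion Subtype.val).card ≤ n / 16
  · have := h2 hN
    omega
  · omega

end Copies

/-! ### From `subgraphIsoFunction` to permuted copies, and the final bound -/

open Classical in
-- `H` and the input hypergraph share the finite vertex set `Fin n`, so an injection between their
-- vertices is a permutation.
theorem subgraphIsoFunction_eq_true_iff {n : ℕ} {H : Hypergraph (Fin n)} (hH : IsThreeUniform H)
    (x : Triple n → Bool) :
    subgraphIsoFunction H x = true ↔ ∃ σ : Equiv.Perm (Fin n),
      ∀ e ∈ Finset.univ.filter (fun e : Triple n => (e.1 : Set (Fin n)) ∈ H.edgeSet),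
        x (e.map σ) = true := by
  rw [subgraphIsoFunction, decide_eq_true_eq]
  constructor
  · rintro ⟨φ, hinj, -, hφ⟩
    rw [hH.vertexSet_eq, Set.injOn_univ] at hinj
    refine ⟨Equiv.ofBijective φ (Finite.injective_iff_bijective.1 hinj), fun e he => ?_⟩
    obtain ⟨s, hs, hes⟩ := hφ _ (Finset.mem_filter.1 he).2
    convert hs
    apply Subtype.ext
    apply Finset.coe_injective
    rw [← hes]
    simp [Triple.map]
  · rintro ⟨σ, hσ⟩
    refine ⟨σ, σ.injective.injOn, fun _ _ => Set.mem_univ _, fun e he => ?_⟩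
    have hcard : e.toFinset.card = 3 := by
      rw [← Set.ncard_eq_toFinset_card']
      exact hH.ncard_eq e he
    refine ⟨Triple.map σ ⟨e.toFinset, hcard⟩, hσ _ ?_, ?_⟩
    · simpa using he
    · simp [Triple.map]

theorem theorem4 :
    ∃ c : ℝ, 0 < c ∧ ∀ (n : ℕ) (H : Hypergraph (Fin n)),
      IsThreeUniform H → H.edgeSet.Nonempty →
        ENNReal.ofReal (c * (n : ℝ) ^ (4 / 5 : ℝ)) ≤
          ((quantumQueryComplexity (subgraphIsoFunction H) : ℕ∞) : ENNReal) := by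
  classical
  refine ⟨1 / 13000, by norm_num, fun n H hH hE => ?_⟩
  have hEne : (Finset.univ.filter
      (fun e : Triple n => (e.1 : Set (Fin n)) ∈ H.edgeSet)).Nonempty := by
    obtain ⟨e, he⟩ := hE
    have hcard : e.toFinset.card = 3 := by
      rw [← Set.ncard_eq_toFinset_card']
      exact hH.ncard_eq e he
    exact ⟨⟨e.toFinset, hcard⟩, by simpa using he⟩
  have key : ∀ A : QueryAlgorithm (Triple n), A.Computes (subgraphIsoFunction H) →
      n ≤ 13000 * A.queries := by
    intro A hA
    refine linear_bound (fun x => ?_) hEne A hA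
    convert subgraphIsoFunction_eq_true_iff hH x
  -- The exponent 4/5 is lost only here: the linear bound is already proved.
  have hpow : (n : ℝ) ^ (4 / 5 : ℝ) ≤ n := by
    rcases Nat.eq_zero_or_pos n with rfl | hn
    · rw [Nat.cast_zero, Real.zero_rpow (by norm_num)]
    · have h1 : (1 : ℝ) ≤ n := by exact_mod_cast hn
      calc (n : ℝ) ^ (4 / 5 : ℝ) ≤ (n : ℝ) ^ (1 : ℝ) :=
            Real.rpow_le_rpow_of_exponent_le h1 (by norm_num)
        _ = n := Real.rpow_one _
  set q := quantumQueryComplexity (subgraphIsoFunction H) with hq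
  rcases eq_or_ne q ⊤ with htop | hne
  · rw [htop]
    simp
  · obtain ⟨m, hm⟩ := ENat.ne_top_iff_exists.1 hne
    -- A finite infimum of natural numbers is attained.
    have hle : ∃ A : QueryAlgorithm (Triple n), A.Computes (subgraphIsoFunction H) ∧
        A.queries ≤ m := by
      by_contra! h
      have : ((m + 1 : ℕ) : ℕ∞) ≤ q := by
        rw [hq, quantumQueryComplexity]
        refine le_iInf fun A => le_iInf fun hA => ?_
        exact_mod_cast h A hA
      rw [← hm] at this
      have : m + 1 ≤ m := by exact_mod_cast this
      omega
    obtain ⟨A, hA, hAm⟩ := hle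
    have h1 : n ≤ 13000 * m := (key A hA).trans (Nat.mul_le_mul_left _ hAm)
    have h2 : (n : ℝ) ≤ 13000 * m := by exact_mod_cast h1
    rw [← hm, ENat.toENNReal_coe]
    refine ENNReal.ofReal_le_of_le_toReal ?_
    rw [ENNReal.toReal_natCast]
    linarith
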